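/- **Setting.** For $a<b$ let $\gamma_0=\frac1{\sqrt{b-a}}$ and $\gamma_k(x)=\sqrt{\tfrac{2}{b-a}}\cos\!\big(\tfrac{k\pi(x-a)}{b-a}\big)$ $(k\ge1)$ for $x\in[a,b]$, and $\gamma_k(x)=0$ for $x\notin[a,b]$. Let $X$ be a real random variable with density $f$ and distribution function $F$. Put $a_k=\mathbb E[\gamma_k(X)]=\int_a^b f\gamma_k$, $f^{\mathcal K}=\sum_{k<\mathcal K}a_k\gamma_k$ and $\Gamma_k(x)=\int_a^x\gamma_k$. Given numbers $\hat a_0,\dots,\hat a_{\mathcal K-1}$, let $\hat F(x)=0$ for $x<a$, $\hat F(x)=\sum_{k=0}^{\mathcal K-1}\hat a_k\Gamma_k(x)$ for $a\le x<b$, and $\hat F(x)=1$ for $x\ge b$. **Oracles.** Let $s>0$, let $x_j$ $(0\le j<2^n)$ be real nodes with $|\gamma_k(x_j)|\le s$ for all $j$ and all $k<\mathcal K$, let $p_j=f(x_j)/\sum_l f(x_l)$, and let $\phi_k=\frac12\big(1+\gamma_k/s\big)$, which is $[0,1]$-valued at the nodes. For $k=0,\dots,\mathcal K-1$ the oracle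 $\mathcal U_{a_k}$ is a unitary on $n+1$ qubits with $$\mathcal U_{a_k}|0\rangle^n|0\rangle=\sum_j\sqrt{p_j\,\phi_k(x_j)}\,|j\rangle|1\rangle+\sum_j\sqrt{p_j\,(1-\phi_k(x_j))}\,|j\rangle|0\rangle .$$ (The choice $s=1$ is possible whenever $b-a\ge2$; the choice $s=\sqrt{2/(b-a)}$ is always possible.) A quantum query algorithm starts in the all-zero state of a workspace and the $n+1$ oracle qubits, applies a finite sequence of operations, each of which is either a fixed unitary that does not depend on the oracles, or one of the $\mathcal U_{a_k}$, or one of the $\mathcal U_{a_k}^{-1}$ (these act on the oracle qubits), and finally measures in the computational basis and computes $(\hat a_0,\dots,\hat a_{\mathcal K-1})\in\mathbb R^{\mathcal K}$ from the outcome. Its number of queries is the total number of uses of the $\mathcal U_{a_k}$ and the $\mathcal U_{a_k}^{-1}$. **Theorem (Quantum complexity recovering the marginal distributions).** There is an absolute constant $C>0$ such that the following holds. For all integers $n\ge0$, $\mathcal K\ge1$ and all reals $a<b$, $\epsilon,\varrho\in(0,1)$, $s>0$ there is a quantum query algorithm, depending only on these parameters, that makes at most $$C\,\frac{s\sqrt{b-a}\;\mathcal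 K^2}{\epsilon}\,\log\frac{\mathcal K}{\varrho}$$ queries and for which, whenever 1. $f$ and $\mathcal K$ satisfy one of the following: * (algebraic case) for some integer $m\ge1$ and some $\zeta>0$, $\sup_{[a,b]}|f^{K}-f|\le\zeta K^{-m}$ for all integers $K\ge1$, and $\mathcal K=\Big\lceil\big(\tfrac{4\zeta(b-a)}{\epsilon}\big)^{1/m}\Big\rceil$; * (exponential case) for some $\nu,\zeta>0$, $\sup_{[a,b]}|f^{K}-f|\le\zeta e^{-\nu K}$ for all integers $K\ge1$, and $\mathcal K=\max\Big\{1,\Big\lceil\log\Big[\big(\tfrac{4\zeta(b-a)}{\epsilon}\big)^{1/\nu}\Big]\Big\rceil\Big\}$; 2. the oracles $\mathcal U_{a_0},\dots,\mathcal U_{a_{\mathcal K-1}}$ are as above, and their Riemann sums are accurate in the sense that $\big|\sum_j p_j\gamma_k(x_j)-a_k\big|\le\frac{\epsilon}{8\mathcal K\sqrt{2(b-a)}}$ for $k<\mathcal K$; 3. $F(a)\le\epsilon/2$ and $F(b)\ge1-\epsilon$; the output satisfies, with probability at least $1-\varrho$, $$|\hat F(x)-F(x)|\le\epsilon\qquad\text{for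 all }x\in\mathbb R .$$ For $s=1$ the number of queries is $O\big(\sqrt{b-a}\,\mathcal K^2\epsilon^{-1}\log(\mathcal K/\varrho)\big)$. -/

import Mathlib

open MeasureTheory ProbabilityTheory

noncomputable section

namespace CosineQAE

/-! ### Cosine series on an interval -/

/-- The orthonormal cosine basis function `γ_k` of `[a, b]`, extended by `0` outside `[a, b]`
(so that `E[γ_k(X)] = ∫_a^b f γ_k` for every random variable `X` with density `f`). -/
def cosBasis (a b : ℝ) (k : ℕ) (x : ℝ) : ℝ :=
  (Set.Icc a b).indicator
    (fun y => if k = 0 then 1 / √(b - a)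
      else √(2 / (b - a)) * Real.cos (k * Real.pi * (y - a) / (b - a))) x

/-- The cosine coefficient `a_k = ∫_a^b f γ_k`. -/
def cosCoeff (f : ℝ → ℝ) (a b : ℝ) (k : ℕ) : ℝ :=
  ∫ x in a..b, f x * cosBasis a b k x

/-- The `K`-term partial sum `f^K = ∑_{k < K} a_k γ_k`. -/
def cosPartialSum (f : ℝ → ℝ) (a b : ℝ) (K : ℕ) (x : ℝ) : ℝ :=
  ∑ k ∈ Finset.range K, cosCoeff f a b k * cosBasis a b k x

/-- `Γ_k(x) = ∫_a^x γ_k`. -/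
def cosPrimitive (a b : ℝ) (k : ℕ) (x : ℝ) : ℝ :=
  ∫ t in a..x, cosBasis a b k t

/-- The approximate distribution function built from estimated coefficients `c_0, …, c_{K-1}`:
`0` on `(-∞, a)`, `∑_k c_k Γ_k` on `[a, b)`, and `1` on `[b, ∞)`. -/
def cdfEstimate (a b : ℝ) {K : ℕ} (c : Fin K → ℝ) (x : ℝ) : ℝ :=
  if x < a then 0
  else if x < b then ∑ k : Fin K, c k * cosPrimitive a b k x
  else 1

/-- Algebraic rate: `sup_{[a,b]} |f^K - f| ≤ ζ K^{-m}` for every `K ≥ 1`. -/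
def AlgebraicRate (f : ℝ → ℝ) (a b ζ : ℝ) (m : ℕ) : Prop :=
  ∀ K : ℕ, 1 ≤ K → ∀ x ∈ Set.Icc a b,
    |cosPartialSum f a b K x - f x| ≤ ζ * (K : ℝ) ^ (-(m : ℝ))

/-- Exponential rate: `sup_{[a,b]} |f^K - f| ≤ ζ e^{-νK}` for every `K ≥ 1`. -/
def ExponentialRate (f : ℝ → ℝ) (a b ζ ν : ℝ) : Prop :=
  ∀ K : ℕ, 1 ≤ K → ∀ x ∈ Set.Icc a b,
    |cosPartialSum f a b K x - f x| ≤ ζ * Real.exp (-ν * K)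

/-! ### Quantum oracles and quantum query algorithms -/

/-- The computational basis of `n` qubits. -/
abbrev Qubits (n : ℕ) : Type := Fin n → Fin 2

/-- The computational basis of the register an oracle acts on: `n` qubits and one ancilla qubit. -/
abbrev OracleReg (n : ℕ) : Type := Qubits n × Fin 2

/-- The normalized weight `f(x_j) / ∑_l f(x_l)` of the node `x_j`. -/
def nodeWeight (f : ℝ → ℝ) {n : ℕ} (x : Qubits n → ℝ) (j : Qubits n) : ℝ :=
  f (x j) / ∑ l, f (x l)

/-- The Riemann sum `∑_j p_j g(x_j)` with the normalized weights `p_j = f(x_j) / ∑_l f(x_l)`. -/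
def riemannSum (f : ℝ → ℝ) {n : ℕ} (x : Qubits n → ℝ) (g : ℝ → ℝ) : ℝ :=
  ∑ j, nodeWeight f x j * g (x j)

/-- `U` loads the density `f` at the nodes `x_j` and the function `φ` into the ancilla:
`U |0⟩|0⟩ = ∑_j √(p_j φ(x_j)) |j⟩|1⟩ + ∑_j √(p_j (1 - φ(x_j))) |j⟩|0⟩`,
where `p_j = f(x_j) / ∑_l f(x_l)` and `φ` takes values in `[0, 1]` at the nodes.
Nothing is required of `U` on the other basis states, except that it is unitary. -/
def Loads {n : ℕ} (U : Matrix.unitaryGroup (OracleReg n) ℂ) (f : ℝ → ℝ) (x : Qubits n → ℝ)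
    (φ : ℝ → ℝ) : Prop :=
  (∀ j, φ (x j) ∈ Set.Icc (0 : ℝ) 1) ∧
  ∀ j, (U : Matrix (OracleReg n) (OracleReg n) ℂ) (j, 1) (0, 0) =
      ((√(nodeWeight f x j * φ (x j)) : ℝ) : ℂ) ∧
    (U : Matrix (OracleReg n) (OracleReg n) ℂ) (j, 0) (0, 0) =
      ((√(nodeWeight f x j * (1 - φ (x j))) : ℝ) : ℂ)

/-- The function loaded for the `k`-th coefficient, `(1 + γ_k / s) / 2`, which has values in
`[0, 1]` wherever `|γ_k| ≤ s`. For `s = √(2 / (b - a))` it is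
`γ_k⁺ = 1/2 + 1/2 √((b - a) / 2) γ_k`. -/
def loadedBasis (a b s : ℝ) (k : ℕ) (x : ℝ) : ℝ :=
  (1 + cosBasis a b k x / s) / 2

/-- One step of a query algorithm with `w` workspace qubits and black boxes `U_0, …, U_{K-1}`
acting on `OracleReg n`: an arbitrary unitary that does not depend on the black boxes, an
application of some `U_k`, or one of its inverse. -/
inductive Step (n K w : ℕ) : Type
  | gate (V : Matrix.unitaryGroup (Qubits w × OracleReg n) ℂ) : Step n K w
  | query (k : Fin K) : Step n K w
  | queryInv (k : Fin K) : Step n K w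

/-- The operator of a step, once the black boxes are given. Queries act on the oracle register
and as the identity on the workspace. -/
def Step.toMatrix {n K w : ℕ} (U : Fin K → Matrix.unitaryGroup (OracleReg n) ℂ) :
    Step n K w → Matrix (Qubits w × OracleReg n) (Qubits w × OracleReg n) ℂ
  | .gate V => V
  | .query k => Matrix.kronecker (1 : Matrix (Qubits w) (Qubits w) ℂ)
      (U k : Matrix (OracleReg n) (OracleReg n) ℂ)
  | .queryInv k => Matrix.kronecker (1 : Matrix (Qubits w) (Qubits w) ℂ)
      ((U k)⁻¹ : Matrix.unitaryGroup (OracleReg n) ℂ)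

/-- The number of queries made by a step. -/
def Step.cost {n K w : ℕ} : Step n K w → ℕ
  | .gate _ => 0
  | .query _ => 1
  | .queryInv _ => 1

/-- A quantum query algorithm: a number of workspace qubits, a finite sequence of steps, and a
classical post-processing of the final measurement in the computational basis that returns `K`
real numbers. -/
structure QueryAlgorithm (n K : ℕ) where
  workspace : ℕ
  steps : List (Step n K workspace)
  output : Qubits workspace × OracleReg n → (Fin K → ℝ)

namespace QueryAlgorithm

variable {n K : ℕ}

/-- The total number of applications of black boxes and of their inverses. -/
def queryCount (A : QueryAlgorithm n K) : ℕ := (A.steps.map Step.cost).sum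

/-- The state before the final measurement, starting from the all-zero basis state; the steps are
applied from left to right. -/
def finalState (A : QueryAlgorithm n K) (U : Fin K → Matrix.unitaryGroup (OracleReg n) ℂ) :
    Qubits A.workspace × OracleReg n → ℂ :=
  A.steps.foldl (fun ψ t => (t.toMatrix U).mulVec ψ) (Pi.single 0 1)

open Classical in
/-- The probability (Born rule) that the output lies in `S`. -/
def outputProb (A : QueryAlgorithm n K) (U : Fin K → Matrix.unitaryGroup (OracleReg n) ℂ)
    (S : Set (Fin K → ℝ)) : ℝ :=
  ∑ z, if A.output z ∈ S then ‖A.finalState U z‖ ^ 2 else 0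

end QueryAlgorithm

end CosineQAE

end

/-!
The `k`-th coefficient is read off from the success probability `μ_k` of the oracle `U_k`, the
probability that the ancilla of `U_k |0⟩` is `1`: the Riemann sum of `γ_k` is `s (2 μ_k - 1)`
(`Loads.riemannSum_cosBasis`). Each `μ_k` is found by quantum amplitude estimation, and a
coefficient error of `ε / (4 K √(2 (b - a)))`, half of it from the Riemann sum and half from the
estimation, gives the distribution function with error `ε` (`abs_cdfEstimate_sub_cdf_le`).

Amplitude estimation is phase estimation for the Grover iterate, which rotates a plane containing
`U_k |0⟩` by `2 θ`, where `sin² θ = μ_k` (`grover_pow_mulVec`). In order to reach the failure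
probability `ϱ / K` in one run, without medians of repeated runs, the control register is prepared
in the window whose amplitudes are the coefficients of `(1 + X + ⋯ + X^(L-1))^r`. The distribution
of the measured phase is then the normalized `2 r`-th power of a Dirichlet kernel. At distance `2 η`
from the peak each kernel is at most `1 / η`; Parseval's identity for one kernel and this bound for
the `r - 1` others, together with the Cauchy–Schwarz lower bound for the norm of the window, leave
the tail at most `r (η L)^(-2 (r - 1))` (`window_tail_le`, `window_sum_sq_ge`,
`exists_amplitude_estimation`). So `L` of order `1 / η` and `r` of order `log (K / ϱ)` suffice, at a
cost of about `2 r L` queries for each coefficient.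

The runs for the different coefficients use disjoint workspaces, so that the final state is a
product state (`Prepares.prod`) and a union bound applies
(`exists_amplitude_estimation_finset`).

The bound on the number of queries can be less than `1` in two cases, which need no query. If
`K = 1`, the uniform distribution on `[a, b]` is accurate enough
(`abs_cdfEstimate_uniform_sub_cdf_le`). If `s √(b - a) < 1`, no node lies in `[a, b]`, the Riemann
sums vanish, and all coefficients are estimated by `0` (`riemannSum_cosBasis_eq_zero`).
-/

namespace CosineQAE

open scoped Matrix Kronecker

/-! ### Circuits over an arbitrary finite workspace -/

/-- The black boxes `U_0, …, U_{K-1}` of a query algorithm. -/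
abbrev Oracles (n K : ℕ) : Type := Fin K → Matrix.unitaryGroup (OracleReg n) ℂ

section Circuits

variable {n K : ℕ}

/-- `Implements W q T`: the operator `T U` on the workspace `W` and the oracle register is a
product of unitaries independent of `U`, of black boxes and of their inverses, with `q` black boxes
in total, by a recipe that is the same for all `U`. The workspace is an arbitrary finite type, so
that circuits can be put side by side without bookkeeping of qubits. -/
inductive Implements (W : Type) [Fintype W] [DecidableEq W] :
    ℕ → (Oracles n K → Matrix (W × OracleReg n) (W × OracleReg n) ℂ) → Prop
  | gate (V : Matrix (W × OracleReg n) (W × OracleReg n) ℂ)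
      (hV : V ∈ Matrix.unitaryGroup (W × OracleReg n) ℂ) : Implements W 0 (fun _ => V)
  | query (k : Fin K) : Implements W 1
      (fun U => (1 : Matrix W W ℂ) ⊗ₖ (U k : Matrix (OracleReg n) (OracleReg n) ℂ))
  | queryInv (k : Fin K) : Implements W 1
      (fun U => (1 : Matrix W W ℂ) ⊗ₖ
        ((U k)⁻¹ : Matrix.unitaryGroup (OracleReg n) ℂ).1)
  | mul {p q : ℕ} {S T : Oracles n K → Matrix (W × OracleReg n) (W × OracleReg n) ℂ} :
      Implements W p S → Implements W q T → Implements W (p + q) (fun U => S U * T U)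

lemma submatrix_mem_unitaryGroup {A B : Type*} [Fintype A] [DecidableEq A] [Fintype B]
    [DecidableEq B] {V : Matrix A A ℂ} (hV : V ∈ Matrix.unitaryGroup A ℂ) (e : B ≃ A) :
    V.submatrix e e ∈ Matrix.unitaryGroup B ℂ := by
  rw [Matrix.mem_unitaryGroup_iff] at hV ⊢
  rw [Matrix.star_eq_conjTranspose] at hV ⊢
  rw [Matrix.conjTranspose_submatrix, Matrix.submatrix_mul_equiv, hV, Matrix.submatrix_one_equiv]

lemma permutation_mem_unitaryGroup {A : Type*} [Fintype A] [DecidableEq A] (σ : A ≃ A) :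
    (1 : Matrix A A ℂ).submatrix σ (Equiv.refl A) ∈ Matrix.unitaryGroup A ℂ := by
  rw [Matrix.mem_unitaryGroup_iff, Matrix.star_eq_conjTranspose, Matrix.conjTranspose_submatrix,
    Matrix.submatrix_mul_equiv]
  simp

lemma one_kronecker_mul {R A : Type*} [Fintype R] [DecidableEq R] [Fintype A]
    (M N : Matrix A A ℂ) :
    (1 : Matrix R R ℂ) ⊗ₖ (M * N) = ((1 : Matrix R R ℂ) ⊗ₖ M) * ((1 : Matrix R R ℂ) ⊗ₖ N) := by
  rw [← Matrix.mul_kronecker_mul, one_mul]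

namespace Implements

variable {W : Type} [Fintype W] [DecidableEq W]

lemma mem_unitaryGroup {q : ℕ}
    {T : Oracles n K → Matrix (W × OracleReg n) (W × OracleReg n) ℂ}
    (h : Implements W q T) (U : Oracles n K) :
    T U ∈ Matrix.unitaryGroup (W × OracleReg n) ℂ := by
  induction h with
  | gate V hV => exact hV
  | query k => exact Matrix.kronecker_mem_unitary (one_mem _) (U k).2
  | queryInv k => exact Matrix.kronecker_mem_unitary (one_mem _) ((U k)⁻¹).2
  | mul _ _ hS hT => exact mul_mem hS hT

lemma reindex {W' : Type} [Fintype W'] [DecidableEq W'] (e : W' ≃ W) {q : ℕ}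
    {T : Oracles n K → Matrix (W × OracleReg n) (W × OracleReg n) ℂ} (h : Implements W q T) :
    Implements W' q (fun U => (T U).submatrix (e.prodCongr (Equiv.refl _))
      (e.prodCongr (Equiv.refl _))) := by
  induction h with
  | gate V hV => exact .gate _ (submatrix_mem_unitaryGroup hV _)
  | query k =>
    convert Implements.query (W := W') k using 2 with U
    ext ⟨i, j⟩ ⟨i', j'⟩
    simp [Matrix.one_apply]
  | queryInv k =>
    convert Implements.queryInv (W := W') k using 2 with U
    ext ⟨i, j⟩ ⟨i', j'⟩
    simp [Matrix.one_apply]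
  | mul _ _ hS hT =>
    simp_rw [← Matrix.submatrix_mul_equiv _ _ _ (e.prodCongr (Equiv.refl _)) _]
    exact .mul hS hT

/-- A circuit can be run in the presence of an idle register `R`. -/
lemma lift (R : Type) [Fintype R] [DecidableEq R] {q : ℕ}
    {T : Oracles n K → Matrix (W × OracleReg n) (W × OracleReg n) ℂ} (h : Implements W q T) :
    Implements (R × W) q (fun U => ((1 : Matrix R R ℂ) ⊗ₖ T U).submatrix
      (Equiv.prodAssoc R W (OracleReg n)) (Equiv.prodAssoc R W (OracleReg n))) := by
  induction h with
  | gate V hV =>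
    exact .gate _ (submatrix_mem_unitaryGroup (Matrix.kronecker_mem_unitary (one_mem _) hV) _)
  | query k =>
    convert Implements.query (W := R × W) k using 2 with U
    ext ⟨⟨i, j⟩, l⟩ ⟨⟨i', j'⟩, l'⟩
    by_cases h1 : i = i' <;> by_cases h2 : j = j' <;> simp [h1, h2]
  | queryInv k =>
    convert Implements.queryInv (W := R × W) k using 2 with U
    ext ⟨⟨i, j⟩, l⟩ ⟨⟨i', j'⟩, l'⟩
    by_cases h1 : i = i' <;> by_cases h2 : j = j' <;> simp [h1, h2]
  | mul _ _ hS hT =>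
    simp_rw [one_kronecker_mul,
      ← Matrix.submatrix_mul_equiv _ _ _ (Equiv.prodAssoc R W (OracleReg n)) _]
    exact .mul hS hT

/-- A circuit on `w` workspace qubits is a sequence of steps of a query algorithm. -/
lemma exists_steps {w q : ℕ}
    {T : Oracles n K → Matrix (Qubits w × OracleReg n) (Qubits w × OracleReg n) ℂ}
    (h : Implements (Qubits w) q T) :
    ∃ l : List (Step n K w), (l.map Step.cost).sum = q ∧
      ∀ U ψ, l.foldl (fun ψ t => (t.toMatrix U).mulVec ψ) ψ = T U *ᵥ ψ := by
  induction h with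
  | gate V hV => exact ⟨[.gate ⟨V, hV⟩], by simp [Step.cost], fun U ψ => by simp [Step.toMatrix]⟩
  | query k => exact ⟨[.query k], by simp [Step.cost], fun U ψ => by simp [Step.toMatrix]⟩
  | queryInv k => exact ⟨[.queryInv k], by simp [Step.cost], fun U ψ => by simp [Step.toMatrix]⟩
  | mul _ _ hS hT =>
    obtain ⟨l, hl, hl'⟩ := hS
    obtain ⟨l', h1, h2⟩ := hT
    refine ⟨l' ++ l, by simp [hl, h1, add_comm], fun U ψ => ?_⟩
    rw [List.foldl_append, h2, hl', Matrix.mulVec_mulVec]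

end Implements

/-- `Prepares W z q Ψ`: some circuit with `q` queries takes the basis state `z` of the workspace
and the zero state of the oracle register to the state `Ψ U`, for all black boxes `U`. -/
def Prepares (W : Type) [Fintype W] [DecidableEq W] (z : W) (q : ℕ)
    (Ψ : Oracles n K → W × OracleReg n → ℂ) : Prop :=
  ∃ T, Implements W q T ∧ ∀ U, T U *ᵥ Pi.single (z, 0) 1 = Ψ U

lemma sum_norm_sq_mulVec_of_mem_unitaryGroup {A : Type*} [Fintype A] [DecidableEq A]
    {V : Matrix A A ℂ} (hV : V ∈ Matrix.unitaryGroup A ℂ) (v : A → ℂ) :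
    ∑ i, ‖(V *ᵥ v) i‖ ^ 2 = ∑ i, ‖v i‖ ^ 2 := by
  have key : ∀ u : A → ℂ, ((∑ i, ‖u i‖ ^ 2 : ℝ) : ℂ) = star u ⬝ᵥ u := fun u => by
    simp [dotProduct, Complex.conj_mul']
  have h : star (V *ᵥ v) ⬝ᵥ (V *ᵥ v) = star v ⬝ᵥ v := by
    rw [Matrix.star_mulVec, ← Matrix.dotProduct_mulVec, Matrix.mulVec_mulVec,
      ← Matrix.star_eq_conjTranspose, Matrix.mem_unitaryGroup_iff'.1 hV, Matrix.one_mulVec]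
  rw [← key, ← key] at h
  exact_mod_cast h

lemma sum_norm_sq_single {A : Type*} [Fintype A] [DecidableEq A] (a : A) :
    ∑ i, ‖(Pi.single a 1 : A → ℂ) i‖ ^ 2 = 1 := by
  rw [Finset.sum_eq_single a]
  · simp
  · intro b _ hb
    simp [hb]
  · simp

lemma lift_mulVec_mul {R W A : Type*} [Fintype R] [DecidableEq R] [Fintype W] [Fintype A]
    (M : Matrix (W × A) (W × A) ℂ) (g : R → ℂ) (φ : W × A → ℂ) :
    (((1 : Matrix R R ℂ) ⊗ₖ M).submatrix (Equiv.prodAssoc R W A) (Equiv.prodAssoc R W A)) *ᵥ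
      (fun x => g x.1.1 * φ (x.1.2, x.2)) = fun x => g x.1.1 * (M *ᵥ φ) (x.1.2, x.2) := by
  ext ⟨⟨r, w⟩, o⟩
  simp only [Matrix.mulVec, dotProduct, Fintype.sum_prod_type, Matrix.submatrix_apply,
    Equiv.prodAssoc_apply, Matrix.kroneckerMap_apply, Matrix.one_apply, Finset.mul_sum]
  rw [Finset.sum_eq_single r]
  · exact Finset.sum_congr rfl fun _ _ => Finset.sum_congr rfl fun _ _ => by simp; ring
  · intro b _ hb
    simp [hb.symm]
  · simp

namespace Prepares

variable {W : Type} [Fintype W] [DecidableEq W] {z : W} {q : ℕ}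
  {Ψ : Oracles n K → W × OracleReg n → ℂ}

lemma sum_norm_sq (h : Prepares W z q Ψ) (U : Oracles n K) : ∑ x, ‖Ψ U x‖ ^ 2 = 1 := by
  obtain ⟨T, hT, hU⟩ := h
  rw [← hU, sum_norm_sq_mulVec_of_mem_unitaryGroup (hT.mem_unitaryGroup U), sum_norm_sq_single]

/-- Two state preparations can be run one after the other on disjoint workspaces: the oracle
register of the first one is stored away before the second one begins, and the result is the
product state. -/
lemma prod {W₁ W₂ : Type} [Fintype W₁] [DecidableEq W₁] [Fintype W₂] [DecidableEq W₂]
    {z₁ : W₁} {z₂ : W₂} {q₁ q₂ : ℕ} {Ψ₁ : Oracles n K → W₁ × OracleReg n → ℂ}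
    {Ψ₂ : Oracles n K → W₂ × OracleReg n → ℂ}
    (h₁ : Prepares W₁ z₁ q₁ Ψ₁) (h₂ : Prepares W₂ z₂ q₂ Ψ₂) :
    Prepares ((W₁ × OracleReg n) × W₂) ((z₁, 0), z₂) (q₁ + q₂)
      (fun U x => Ψ₁ U x.1.1 * Ψ₂ U (x.1.2, x.2)) := by
  obtain ⟨T₁, hT₁, hU₁⟩ := h₁
  obtain ⟨T₂, hT₂, hU₂⟩ := h₂
  -- `e` lists the spectators of the first circuit first; `σ` swaps the oracle register with its
  -- storage.
  let e : (W₁ × OracleReg n) × W₂ ≃ (OracleReg n × W₂) × W₁ :=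
    { toFun := fun x => ((x.1.2, x.2), x.1.1)
      invFun := fun x => ((x.2, x.1.1), x.1.2)
      left_inv := fun _ => rfl
      right_inv := fun _ => rfl }
  let σ : ((W₁ × OracleReg n) × W₂) × OracleReg n ≃ ((W₁ × OracleReg n) × W₂) × OracleReg n :=
    { toFun := fun x => (((x.1.1.1, x.2), x.1.2), x.1.1.2)
      invFun := fun x => (((x.1.1.1, x.2), x.1.2), x.1.1.2)
      left_inv := fun _ => rfl
      right_inv := fun _ => rfl }
  have hcirc := (hT₂.lift (W₁ × OracleReg n)).mul
    ((Implements.gate _ (permutation_mem_unitaryGroup σ)).mul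
      ((hT₁.lift (OracleReg n × W₂)).reindex e))
  rw [show q₂ + (0 + q₁) = q₁ + q₂ by ring] at hcirc
  refine ⟨_, hcirc, fun U => ?_⟩
  rw [← Matrix.mulVec_mulVec, ← Matrix.mulVec_mulVec,
    Matrix.submatrix_mulVec_equiv _ _ _ (e.prodCongr (Equiv.refl (OracleReg n)))]
  have s1 : (Pi.single ((((z₁, 0), z₂), 0) : ((W₁ × OracleReg n) × W₂) × OracleReg n) (1 : ℂ)) ∘
      (e.prodCongr (Equiv.refl (OracleReg n))).symm =
      fun x => (Pi.single ((0, z₂) : OracleReg n × W₂) (1 : ℂ) : _ → ℂ) x.1.1 *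
        (Pi.single ((z₁, 0) : W₁ × OracleReg n) (1 : ℂ) : _ → ℂ) (x.1.2, x.2) := by
    ext ⟨⟨⟨o', w₂⟩, w₁⟩, o⟩
    simp only [Function.comp, Pi.single_apply, e]
    by_cases a1 : o' = 0 <;> by_cases a2 : w₂ = z₂ <;> by_cases a3 : w₁ = z₁ <;>
      by_cases a4 : o = 0 <;> simp [a1, a2, a3, a4]
  rw [s1, lift_mulVec_mul, hU₁, Matrix.submatrix_mulVec_equiv _ _ σ (Equiv.refl _), Matrix.one_mulVec]
  simp only [← hU₂]
  rw [← lift_mulVec_mul]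
  congr 1
  ext ⟨⟨⟨w₁, o'⟩, w₂⟩, o⟩
  simp only [Function.comp, Pi.single_apply, e, σ]
  by_cases a2 : w₂ = z₂ <;> by_cases a4 : o = 0 <;> simp [a2, a4]

open Classical in
/-- A state preparation on a workspace with `2 ^ w` basis states is a query algorithm. -/
lemma exists_algorithm {w : ℕ} (hw : Fintype.card W = 2 ^ w) (h : Prepares W z q Ψ)
    (out : W × OracleReg n → Fin K → ℝ) :
    ∃ A : QueryAlgorithm n K, A.queryCount = q ∧ ∀ U S,
      A.outputProb U S = 1 - ∑ x with out x ∉ S, ‖Ψ U x‖ ^ 2 := by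
  have hsum := h.sum_norm_sq
  obtain ⟨T, hT, hU⟩ := h
  obtain ⟨e, he⟩ : ∃ e : Qubits w ≃ W, e 0 = z := by
    have e₀ : Qubits w ≃ W := Fintype.equivOfCardEq (by simp [hw])
    exact ⟨e₀.trans (Equiv.swap (e₀ 0) z), by simp⟩
  obtain ⟨l, hl, hlU⟩ := (hT.reindex e).exists_steps
  refine ⟨⟨w, l, fun x => out (e x.1, x.2)⟩, hl, fun U S => ?_⟩
  have hfin : ∀ x : Qubits w × OracleReg n,
      (QueryAlgorithm.finalState ⟨w, l, fun x => out (e x.1, x.2)⟩ U) x = Ψ U (e x.1, x.2) := by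
    intro x
    rw [QueryAlgorithm.finalState, hlU, Matrix.submatrix_mulVec_equiv, ← hU]
    have : (Pi.single (0 : Qubits w × OracleReg n) (1 : ℂ)) ∘
        (e.prodCongr (Equiv.refl (OracleReg n))).symm = Pi.single (z, 0) 1 := by
      ext ⟨y, o⟩
      simp only [Function.comp, Pi.single_apply, ← he]
      congr 1
      simp [Prod.ext_iff, Equiv.symm_apply_eq]
    rw [this]
    rfl
  rw [← hsum U, ← Finset.sum_filter_add_sum_filter_not Finset.univ (fun x => out x ∈ S),
    add_sub_cancel_right, Finset.sum_filter]
  simp only [QueryAlgorithm.outputProb, hfin]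
  exact Fintype.sum_equiv (e.prodCongr (Equiv.refl _)) _ _ fun x => rfl

end Prepares

end Circuits

/-! ### Controlled operations, state preparation and the Fourier transform -/

section Gates

/-- The operator `∑_a |a⟩⟨a| ⊗ G_a`, which applies `G_a` to the second register if the first one
is in the state `a`. -/
def controlled {A B : Type*} [DecidableEq A] (G : A → Matrix B B ℂ) :
    Matrix (A × B) (A × B) ℂ :=
  (Matrix.blockDiagonal G).submatrix Prod.swap Prod.swap

variable {A B : Type*}

lemma controlled_mul [Fintype A] [DecidableEq A] [Fintype B] (G H : A → Matrix B B ℂ) :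
    controlled G * controlled H = controlled (fun a => G a * H a) := by
  rw [controlled, controlled, controlled, Matrix.blockDiagonal_mul]
  exact Matrix.submatrix_mul_equiv _ _ Prod.swap (Equiv.prodComm A B) Prod.swap

lemma controlled_mem_unitaryGroup [Fintype A] [DecidableEq A] [Fintype B] [DecidableEq B]
    {G : A → Matrix B B ℂ}
    (hG : ∀ a, G a ∈ Matrix.unitaryGroup B ℂ) :
    controlled G ∈ Matrix.unitaryGroup (A × B) ℂ := by
  refine submatrix_mem_unitaryGroup ?_ (Equiv.prodComm A B)
  rw [Matrix.mem_unitaryGroup_iff, Matrix.star_eq_conjTranspose,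
    Matrix.blockDiagonal_conjTranspose, ← Matrix.blockDiagonal_mul, ← Matrix.blockDiagonal_one]
  congr 1
  funext a
  exact Matrix.mem_unitaryGroup_iff.1 (hG a)

lemma controlled_const [DecidableEq A] (M : Matrix B B ℂ) :
    controlled (fun _ : A => M) = (1 : Matrix A A ℂ) ⊗ₖ M := by
  ext ⟨a, b⟩ ⟨a', b'⟩
  simp [controlled, Matrix.blockDiagonal_apply, Matrix.one_apply]

lemma controlled_mulVec [Fintype A] [DecidableEq A] [Fintype B]
    (G : A → Matrix B B ℂ) (ψ : A × B → ℂ) (a : A) (b : B) :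
    (controlled G *ᵥ ψ) (a, b) = (G a *ᵥ fun b' => ψ (a, b')) b := by
  simp [controlled, Matrix.mulVec, dotProduct, Fintype.sum_prod_type, Matrix.blockDiagonal_apply,
    ite_mul]

lemma kronecker_one_mulVec [Fintype A] [Fintype B] [DecidableEq B]
    (M : Matrix A A ℂ) (ψ : A × B → ℂ) (a : A) (b : B) :
    ((M ⊗ₖ (1 : Matrix B B ℂ)) *ᵥ ψ) (a, b) = ∑ a', M a a' * ψ (a', b) := by
  simp [Matrix.mulVec, dotProduct, Fintype.sum_prod_type, Matrix.one_apply]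

/-- Every unit vector is the column of a unitary matrix. -/
lemma exists_unitary_column [Fintype A] [DecidableEq A] (z : A) (v : A → ℂ) (hv : ∑ a, ‖v a‖ ^ 2 = 1) :
    ∃ V ∈ Matrix.unitaryGroup A ℂ, ∀ a, V a z = v a := by
  have hnorm : ‖WithLp.toLp 2 v‖ = 1 := by
    rw [EuclideanSpace.norm_eq, Real.sqrt_eq_one]
    exact hv
  have ho : Orthonormal ℂ (({z} : Set A).domRestrict (fun _ : A => WithLp.toLp 2 v)) := by
    refine ⟨fun _ => hnorm, fun i j hij => (hij (Subsingleton.elim i j)).elim⟩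
  obtain ⟨b, hb⟩ := ho.exists_orthonormalBasis_extension_of_card_eq
    (E := EuclideanSpace ℂ A) (by simp)
  refine ⟨_, (EuclideanSpace.basisFun A ℂ).toMatrix_orthonormalBasis_mem_unitary b, fun a => ?_⟩
  simp [Module.Basis.toMatrix_apply, hb z rfl]

/-- The unitary discrete Fourier transform, with kernel `e^(-2πi y m / N) / √N`. -/
noncomputable def fourierMatrix (N : ℕ) [NeZero N] : Matrix (ZMod N) (ZMod N) ℂ :=
  Matrix.of fun y m => ZMod.stdAddChar (-(y * m)) / (√N : ℂ)

lemma fourierMatrix_mem_unitaryGroup (N : ℕ) [NeZero N] :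
    fourierMatrix N ∈ Matrix.unitaryGroup (ZMod N) ℂ := by
  rw [Matrix.mem_unitaryGroup_iff]
  ext y y'
  have hN : (√N : ℂ) * (√N : ℂ) = N := by
    rw [← Complex.ofReal_mul, Real.mul_self_sqrt (Nat.cast_nonneg N), Complex.ofReal_natCast]
  have h0 : (N : ℂ) ≠ 0 := Nat.cast_ne_zero.2 (NeZero.ne N)
  have h1 : ∀ m : ZMod N, fourierMatrix N y m * star (fourierMatrix N y' m) =
      ZMod.stdAddChar (m * (y' - y)) / (N : ℂ) := fun m => by
    simp only [fourierMatrix, Matrix.of_apply, star_div₀, RCLike.star_def, Complex.conj_ofReal]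
    rw [← AddChar.map_neg_eq_conj, div_mul_div_comm, hN, ← AddChar.map_add_eq_mul]
    congr 2
    ring
  simp only [Matrix.mul_apply, Matrix.star_apply, h1]
  rw [← Finset.sum_div, AddChar.sum_mulShift _ (ZMod.isPrimitive_stdAddChar N), Matrix.one_apply]
  by_cases h : y = y'
  · simp [h, h0]
  · simp [h, sub_eq_zero, Ne.symm h]

end Gates

/-! ### A window with small tails -/

section Window

open Polynomial

/-- The window of phase estimation: its amplitudes are the coefficients of
`(1 + X + ⋯ + X^(L-1))^r`, so that its Fourier transform is the `r`-th power of a Dirichlet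
kernel. -/
noncomputable def window (r L : ℕ) : ℝ[X] := (∑ l ∈ Finset.range L, X ^ l) ^ r

lemma natDegree_window_le (r L : ℕ) : (window r L).natDegree ≤ r * (L - 1) := by
  refine natDegree_pow_le_of_le r (natDegree_sum_le_of_forall_le _ _ fun l hl => ?_)
  rw [natDegree_X_pow]
  have := Finset.mem_range.1 hl
  omega

lemma sum_zmod_val {N : ℕ} [NeZero N] {E : Type*} [AddCommMonoid E] (f : ℕ → E) :
    ∑ m : ZMod N, f m.val = ∑ i ∈ Finset.range N, f i := by
  refine Finset.sum_bij' (fun m _ => m.val) (fun i _ => (i : ZMod N)) ?_ ?_ ?_ ?_ ?_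
  · exact fun m _ => Finset.mem_range.2 m.val_lt
  · simp
  · simp
  · exact fun i hi => ZMod.val_cast_of_lt (Finset.mem_range.1 hi)
  · simp

/-- The squared norm of the window, bounded below by the Cauchy–Schwarz inequality: the
`r (L - 1) + 1 ≤ r L` coefficients sum to `L ^ r`. -/
lemma window_sum_sq_ge {r L N : ℕ} [NeZero N] (hr : 1 ≤ r) (hL : 1 ≤ L) (hN : r * (L - 1) < N) :
    (L : ℝ) ^ (2 * r) ≤ r * L * ∑ m : ZMod N, (window r L).coeff m.val ^ 2 := by
  have hdeg := natDegree_window_le r L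
  have h1 : ∑ i ∈ Finset.range (r * (L - 1) + 1), (window r L).coeff i = (L : ℝ) ^ r := by
    have := (window r L).eval_eq_sum_range' (Nat.lt_succ_of_le hdeg) 1
    simp only [one_pow, mul_one] at this
    rw [← this]
    simp [window, eval_finsetSum]
  have h2 := sq_sum_le_card_mul_sum_sq (s := Finset.range (r * (L - 1) + 1))
    (f := fun i => (window r L).coeff i)
  rw [h1, Finset.card_range, ← pow_mul, mul_comm r 2] at h2
  rw [sum_zmod_val (fun i => (window r L).coeff i ^ 2)]
  have h3 : ((r * (L - 1) + 1 : ℕ) : ℝ) ≤ r * L := by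
    have : r * (L - 1) + 1 ≤ r * L := by
      obtain ⟨l, rfl⟩ := Nat.exists_eq_add_of_le' hL
      simp only [Nat.add_sub_cancel]
      nlinarith
    exact_mod_cast this
  refine h2.trans (mul_le_mul h3 (Finset.sum_le_sum_of_subset_of_nonneg ?_ fun _ _ _ => sq_nonneg _)
    (Finset.sum_nonneg fun _ _ => sq_nonneg _) (by positivity))
  exact Finset.range_subset_range.2 hN

variable {N : ℕ} [NeZero N]

lemma stdAddChar_neg_mul_mul_pow (y m : ZMod N) (u : ℂ) :
    ZMod.stdAddChar (-(y * m)) * u ^ m.val = (ZMod.stdAddChar (-y) * u) ^ m.val := by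
  rw [mul_pow, ← AddChar.map_nsmul_eq_pow, nsmul_eq_mul, ZMod.natCast_zmod_val, mul_neg, mul_comm m y]

lemma fourier_window {r L : ℕ} (hN : r * (L - 1) < N) (u : ℂ) (y : ZMod N) :
    ∑ m, fourierMatrix N y m * (((window r L).coeff m.val : ℂ) * u ^ m.val) =
      (∑ l ∈ Finset.range L, (ZMod.stdAddChar (-y) * u) ^ l) ^ r / (√N : ℂ) := by
  have h1 : ∀ m : ZMod N, fourierMatrix N y m * (((window r L).coeff m.val : ℂ) * u ^ m.val) =
      ((window r L).coeff m.val : ℂ) * (ZMod.stdAddChar (-y) * u) ^ m.val / (√N : ℂ) := fun m => by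
    rw [← stdAddChar_neg_mul_mul_pow, fourierMatrix, Matrix.of_apply]
    ring
  simp only [h1]
  rw [← Finset.sum_div,
    sum_zmod_val (fun i => ((window r L).coeff i : ℂ) * (ZMod.stdAddChar (-y) * u) ^ i)]
  have := (window r L).aeval_eq_sum_range' ((natDegree_window_le r L).trans_lt hN)
    (ZMod.stdAddChar (-y) * u)
  simp only [Complex.real_smul] at this
  rw [← this]
  simp [window]

/-- Parseval's identity for one Dirichlet kernel. -/
lemma sum_norm_sq_dirichlet {L : ℕ} (hN : L ≤ N) {u : ℂ} (hu : ‖u‖ = 1) :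
    ∑ y : ZMod N, ‖(∑ l ∈ Finset.range L, (ZMod.stdAddChar (-y) * u) ^ l) / (√N : ℂ)‖ ^ 2 = L := by
  have h := sum_norm_sq_mulVec_of_mem_unitaryGroup (fourierMatrix_mem_unitaryGroup N)
    (fun m => if m.val < L then u ^ m.val else 0)
  have hr : ∑ m : ZMod N, ‖(if m.val < L then u ^ m.val else 0 : ℂ)‖ ^ 2 = L := by
    rw [sum_zmod_val (fun i => ‖(if i < L then u ^ i else 0 : ℂ)‖ ^ 2)]
    rw [← Finset.sum_subset (Finset.range_subset_range.2 hN)]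
    · rw [Finset.sum_congr rfl (g := fun _ => (1 : ℝ))]
      · simp
      · intro i hi
        simp [Finset.mem_range.1 hi, hu]
    · intro i _ hi
      simp [Finset.mem_range.not.1 hi]
  rw [← hr, ← h]
  refine Finset.sum_congr rfl fun y _ => ?_
  congr 2
  have h1 : ∀ m : ZMod N, fourierMatrix N y m * (if m.val < L then u ^ m.val else 0) =
      (if m.val < L then (ZMod.stdAddChar (-y) * u) ^ m.val else 0) / (√N : ℂ) := fun m => by
    split_ifs
    · rw [← stdAddChar_neg_mul_mul_pow, fourierMatrix, Matrix.of_apply]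
      ring
    · simp
  rw [Matrix.mulVec, dotProduct]
  simp only [h1]
  rw [← Finset.sum_div,
    sum_zmod_val (fun i => if i < L then (ZMod.stdAddChar (-y) * u) ^ i else 0),
    ← Finset.sum_subset (Finset.range_subset_range.2 hN)]
  · congr 1
    exact Finset.sum_congr rfl fun i hi => by simp [Finset.mem_range.1 hi]
  · intro i _ hi
    simp [Finset.mem_range.not.1 hi]

lemma norm_geom_sum_le {z : ℂ} (hz : ‖z‖ = 1) {η : ℝ} (hη : 0 < η) (h : 2 * η ≤ ‖z - 1‖) (L : ℕ) :
    ‖∑ l ∈ Finset.range L, z ^ l‖ ≤ 1 / η := by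
  have h1 : ‖∑ l ∈ Finset.range L, z ^ l‖ * ‖z - 1‖ ≤ 2 := by
    rw [← norm_mul, geom_sum_mul]
    refine (norm_sub_le _ _).trans ?_
    rw [norm_pow, hz]
    norm_num
  rw [le_div_iff₀ hη]
  nlinarith [norm_nonneg (∑ l ∈ Finset.range L, z ^ l)]

/-- The tail of the Fourier transform of the window. Away from the peak each Dirichlet kernel is at
most `1 / η`; this is used for all but one of them, and Parseval's identity for the last one. In
this way no factor depending on `N` is lost. -/
lemma window_tail_le {r L : ℕ} (hr : 1 ≤ r) (hN : r * (L - 1) < N) (hLN : L ≤ N)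
    {u : ℂ} (hu : ‖u‖ = 1) {η : ℝ} (hη : 0 < η) (B : Finset (ZMod N))
    (hB : ∀ y ∈ B, 2 * η ≤ ‖ZMod.stdAddChar y - u‖) :
    ∑ y ∈ B, ‖∑ m, fourierMatrix N y m * (((window r L).coeff m.val : ℂ) * u ^ m.val)‖ ^ 2 ≤
      (1 / η) ^ (2 * (r - 1)) * L := by
  rw [← sum_norm_sq_dirichlet hLN hu, Finset.mul_sum]
  refine le_trans ?_ (Finset.sum_le_sum_of_subset_of_nonneg (Finset.subset_univ B)
    fun _ _ _ => by positivity)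
  refine Finset.sum_le_sum fun y hy => ?_
  rw [fourier_window hN]
  set z : ℂ := ZMod.stdAddChar (-y) * u with hz
  have hz1 : ‖z‖ = 1 := by rw [hz, norm_mul, AddChar.norm_apply, hu, one_mul]
  have hz2 : 2 * η ≤ ‖z - 1‖ := by
    refine (hB y hy).trans (le_of_eq ?_)
    have : ZMod.stdAddChar y * (z - 1) = u - ZMod.stdAddChar y := by
      rw [hz, mul_sub, ← mul_assoc, ← AddChar.map_add_eq_mul]
      simp
    rw [norm_sub_rev, ← this, norm_mul, AddChar.norm_apply, one_mul]
  have hD := norm_geom_sum_le hz1 hη hz2 L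
  set D := ∑ l ∈ Finset.range L, z ^ l
  have hDr : ‖D ^ r / (√N : ℂ)‖ ^ 2 = (‖D‖ ^ (2 * (r - 1))) * ‖D / (√N : ℂ)‖ ^ 2 := by
    obtain ⟨r, rfl⟩ := Nat.exists_eq_add_of_le' hr
    rw [norm_div, norm_pow, norm_div, Nat.add_sub_cancel, div_pow, div_pow]
    ring
  rw [hDr]
  gcongr

end Window

/-! ### Grover iterates -/

section Grover

variable {n : ℕ}

/-- The probability that the ancilla of `U |0⟩` is measured to be `1`. -/
noncomputable def successProb (U : Matrix.unitaryGroup (OracleReg n) ℂ) : ℝ :=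
  ∑ j, ‖(U : Matrix (OracleReg n) (OracleReg n) ℂ) (j, 1) 0‖ ^ 2

/-- The reflection `2 |0⟩⟨0| - 1` about the zero state. -/
def zeroReflection (n : ℕ) : Matrix (OracleReg n) (OracleReg n) ℂ :=
  Matrix.diagonal fun o => if o = 0 then 1 else -1

/-- The phase flip of the states with ancilla `1`. -/
def ancillaFlip (n : ℕ) : Matrix (OracleReg n) (OracleReg n) ℂ :=
  Matrix.diagonal fun o => if o.2 = 1 then -1 else 1

/-- The Grover iterate `U S_0 U⁻¹ S_χ` of amplitude estimation. -/
def grover (U : Matrix.unitaryGroup (OracleReg n) ℂ) : Matrix (OracleReg n) (OracleReg n) ℂ :=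
  U.1 * zeroReflection n * (U⁻¹).1 * ancillaFlip n

lemma diagonal_sign_mem_unitaryGroup {A : Type*} [Fintype A] [DecidableEq A] {d : A → ℂ}
    (hd : ∀ a, d a = 1 ∨ d a = -1) : Matrix.diagonal d ∈ Matrix.unitaryGroup A ℂ := by
  rw [Matrix.mem_unitaryGroup_iff, Matrix.star_eq_conjTranspose, Matrix.diagonal_conjTranspose,
    Matrix.diagonal_mul_diagonal, ← Matrix.diagonal_one]
  congr 1
  funext a
  rcases hd a with h | h <;> simp [h]

lemma zeroReflection_mem_unitaryGroup : zeroReflection n ∈ Matrix.unitaryGroup _ ℂ :=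
  diagonal_sign_mem_unitaryGroup fun o => by by_cases h : o = 0 <;> simp [h]

lemma ancillaFlip_mem_unitaryGroup : ancillaFlip n ∈ Matrix.unitaryGroup _ ℂ :=
  diagonal_sign_mem_unitaryGroup fun o => by by_cases h : o.2 = 1 <;> simp [h]

lemma zeroReflection_mulVec (v : OracleReg n → ℂ) :
    zeroReflection n *ᵥ v = (2 * v 0) • Pi.single 0 1 - v := by
  ext o
  rw [zeroReflection, Matrix.mulVec_diagonal]
  by_cases h : o = 0
  · subst h
    simp
    ring
  · simp [h]

lemma sum_norm_sq_column (U : Matrix.unitaryGroup (OracleReg n) ℂ) :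
    successProb U + ∑ j, ‖U.1 (j, 0) 0‖ ^ 2 = 1 := by
  have h := sum_norm_sq_mulVec_of_mem_unitaryGroup U.2 (Pi.single 0 1)
  rw [Matrix.mulVec_single_one, sum_norm_sq_single, Fintype.sum_prod_type] at h
  simp only [Fin.sum_univ_two, Finset.sum_add_distrib, Matrix.col_apply] at h
  rw [successProb, add_comm, h]

/-- The Grover iterate on the plane spanned by the two components of `U |0⟩`. -/
lemma grover_mulVec (U : Matrix.unitaryGroup (OracleReg n) ℂ) (α β : ℝ) :
    grover U *ᵥ (fun o => (((if o.2 = 1 then α else β : ℝ)) : ℂ) * U.1 o 0) =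
      fun o => (((if o.2 = 1 then
        2 * ((1 - successProb U) * β - successProb U * α) + α else
        2 * ((1 - successProb U) * β - successProb U * α) - β : ℝ)) : ℂ) * U.1 o 0 := by
  set μ := successProb U with hμ
  have hflip : ancillaFlip n *ᵥ (fun o => (((if o.2 = 1 then α else β : ℝ)) : ℂ) * U.1 o 0) =
      fun o => (((if o.2 = 1 then -α else β : ℝ)) : ℂ) * U.1 o 0 := by
    ext o
    rw [ancillaFlip, Matrix.mulVec_diagonal]
    by_cases h : o.2 = 1 <;> simp [h]
  have hinner : ((U⁻¹).1 *ᵥ fun o => (((if o.2 = 1 then -α else β : ℝ)) : ℂ) * U.1 o 0) 0 =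
      (((1 - μ) * β - μ * α : ℝ) : ℂ) := by
    have h0 : ((1 - μ : ℝ) : ℂ) = ∑ j, (starRingEnd ℂ) (U.1 (j, 0) 0) * U.1 (j, 0) 0 := by
      rw [show 1 - μ = ∑ j, ‖U.1 (j, 0) 0‖ ^ 2 by rw [← sum_norm_sq_column U, hμ]; ring]
      simp [Complex.conj_mul']
    have h1 : (μ : ℂ) = ∑ j, (starRingEnd ℂ) (U.1 (j, 1) 0) * U.1 (j, 1) 0 := by
      rw [hμ, successProb]
      simp [Complex.conj_mul']
    rw [Complex.ofReal_sub, Complex.ofReal_mul, Complex.ofReal_mul, h0, h1, Finset.sum_mul,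
      Finset.sum_mul, ← Finset.sum_sub_distrib, Matrix.UnitaryGroup.inv_val, Matrix.mulVec,
      dotProduct, Fintype.sum_prod_type]
    refine Finset.sum_congr rfl fun j _ => ?_
    simp
    ring
  rw [grover, ← Matrix.mulVec_mulVec, hflip, ← Matrix.mulVec_mulVec, ← Matrix.mulVec_mulVec,
    zeroReflection_mulVec, hinner, Matrix.mulVec_sub, Matrix.mulVec_smul, Matrix.mulVec_mulVec,
    Matrix.mulVec_single_one, Matrix.UnitaryGroup.inv_val, Matrix.mem_unitaryGroup_iff.1 U.2,
    Matrix.one_mulVec]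
  ext o
  by_cases h : o.2 = 1 <;> simp [h] <;> ring

/-- Grover iterates rotate by `2 θ`, where `sin² θ` is the success probability. The coefficients
of the two components of `U |0⟩` are given multiplied by `sin θ` and `cos θ`, so that the
degenerate angles need no separate treatment. -/
lemma grover_pow_mulVec (U : Matrix.unitaryGroup (OracleReg n) ℂ) {θ : ℝ}
    (hθ : Real.sin θ ^ 2 = successProb U) (m : ℕ) :
    ∃ α β : ℝ, ((grover U ^ m) *ᵥ fun o => U.1 o 0) =
        (fun o => (((if o.2 = 1 then α else β : ℝ)) : ℂ) * U.1 o 0) ∧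
      Real.sin θ * α = Real.sin ((2 * m + 1) * θ) ∧
      Real.cos θ * β = Real.cos ((2 * m + 1) * θ) := by
  induction m with
  | zero => exact ⟨1, 1, by simp, by simp, by simp⟩
  | succ m ih =>
    obtain ⟨α, β, h, hs, hc⟩ := ih
    have hc2 : 1 - Real.sin θ ^ 2 = Real.cos θ ^ 2 := by rw [Real.cos_sq']
    refine ⟨2 * ((1 - successProb U) * β - successProb U * α) + α,
      2 * ((1 - successProb U) * β - successProb U * α) - β, ?_, ?_, ?_⟩
    · rw [pow_succ', ← Matrix.mulVec_mulVec, h, grover_mulVec]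
    · rw [show (2 * ((m + 1 : ℕ) : ℝ) + 1) * θ = (2 * m + 1) * θ + 2 * θ by push_cast; ring,
        Real.sin_add, ← hs, ← hc, Real.sin_two_mul, Real.cos_two_mul, ← hθ, hc2]
      linear_combination (2 * Real.sin θ * α) * hc2
    · rw [show (2 * ((m + 1 : ℕ) : ℝ) + 1) * θ = (2 * m + 1) * θ + 2 * θ by push_cast; ring,
        Real.cos_add, ← hs, ← hc, Real.sin_two_mul, Real.cos_two_mul, ← hθ, hc2]
      ring

end Grover

/-! ### Amplitude estimation -/

section AmplitudeEstimation

variable {n K : ℕ}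

/-- The controlled power of the Grover iterate. Only the reflections have to be controlled: without
them a Grover iterate is `U U⁻¹ = 1`. -/
lemma implements_controlled_grover (k : Fin K) (N : ℕ) [NeZero N] (D : ℕ) :
    Implements (n := n) (K := K) (ZMod N) (2 * D)
      (fun U => controlled fun m : ZMod N => grover (U k) ^ min m.val D) := by
  induction D with
  | zero =>
    simp only [Nat.min_zero, pow_zero]
    exact .gate _ (controlled_mem_unitaryGroup fun _ => one_mem _)
  | succ D ih =>
    have hS : controlled (fun m : ZMod N => if D < m.val then zeroReflection n else 1) ∈
        Matrix.unitaryGroup (ZMod N × OracleReg n) ℂ := controlled_mem_unitaryGroup fun m => by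
      split_ifs
      · exact zeroReflection_mem_unitaryGroup
      · exact one_mem _
    have hF : controlled (fun m : ZMod N => if D < m.val then ancillaFlip n else 1) ∈
        Matrix.unitaryGroup (ZMod N × OracleReg n) ℂ := controlled_mem_unitaryGroup fun m => by
      split_ifs
      · exact ancillaFlip_mem_unitaryGroup
      · exact one_mem _
    have h := ((((Implements.query k).mul (.gate _ hS)).mul (.queryInv k)).mul (.gate _ hF)).mul ih
    convert h using 1
    · ring
    · funext U
      simp only [← controlled_const, controlled_mul]
      congr 1
      funext m
      split_ifs with hm
      · rw [min_eq_right hm, min_eq_right hm.le, pow_succ', grover]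
      · rw [min_eq_left (by omega), min_eq_left (by omega), mul_one, mul_one,
          ← Matrix.UnitaryGroup.mul_val, mul_inv_cancel]
        simp

/-- The state of amplitude estimation with window `w` before the final measurement. -/
lemma prepares_phase_estimation (k : Fin K) {N : ℕ} [NeZero N] (D : ℕ) {w : ZMod N → ℂ}
    (hw : ∑ m, ‖w m‖ ^ 2 = 1) :
    Prepares (n := n) (K := K) (ZMod N) 0 (1 + 2 * D) (fun U x =>
      ∑ m, fourierMatrix N x.1 m *
        (w m * ((grover (U k) ^ min m.val D) *ᵥ fun o => (U k).1 o 0) x.2)) := by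
  obtain ⟨V, hV, hVw⟩ := exists_unitary_column 0 w hw
  have h := (Implements.gate (n := n) (K := K) _
    (Matrix.kronecker_mem_unitary (fourierMatrix_mem_unitaryGroup N) (one_mem _))).mul
    ((implements_controlled_grover k N D).mul ((Implements.query k).mul
      (.gate _ (Matrix.kronecker_mem_unitary hV (one_mem _)))))
  rw [show 0 + (2 * D + (1 + 0)) = 1 + 2 * D by ring] at h
  refine ⟨_, h, fun U => ?_⟩
  simp only [← Matrix.mulVec_mulVec]
  have h1 : (V ⊗ₖ (1 : Matrix (OracleReg n) (OracleReg n) ℂ)) *ᵥ Pi.single (0, 0) 1 =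
      fun x => w x.1 * (Pi.single 0 1 : OracleReg n → ℂ) x.2 := by
    ext ⟨m, o⟩
    rw [Matrix.mulVec_single_one, Matrix.col_apply, Matrix.kroneckerMap_apply, hVw,
      Matrix.one_apply, Pi.single_apply]
  have h2 : ∀ (G : ZMod N → Matrix (OracleReg n) (OracleReg n) ℂ) (v : OracleReg n → ℂ),
      controlled G *ᵥ (fun x => w x.1 * v x.2) = fun x => w x.1 * (G x.1 *ᵥ v) x.2 := by
    intro G v
    ext ⟨m, o⟩
    rw [controlled_mulVec]
    exact congrFun (Matrix.mulVec_smul (G m) (w m) v) o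
  ext ⟨y, o⟩
  rw [h1, ← controlled_const, h2]
  have h3 : ((U k).1 *ᵥ Pi.single 0 1) = fun o => (U k).1 o 0 := by
    rw [Matrix.mulVec_single_one]
    rfl
  simp only [h3]
  rw [kronecker_one_mulVec]
  have h4 := h2 (fun m => grover (U k) ^ min m.val D) (fun o => (U k).1 o 0)
  simp only [h4]

/-- Phase estimation as a sum over the two eigenphases `± 2 θ` of the Grover iterate. -/
lemma sum_norm_sq_phase_estimation (U : Matrix.unitaryGroup (OracleReg n) ℂ) {θ : ℝ}
    (hθ : Real.sin θ ^ 2 = successProb U) {ι : Type*} [Fintype ι] (c : ι → ℂ) (p : ι → ℕ) :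
    ∑ o, ‖∑ m, c m * ((grover U ^ p m) *ᵥ fun o => U.1 o 0) o‖ ^ 2 =
      (‖∑ m, c m * Complex.exp (2 * θ * Complex.I) ^ p m‖ ^ 2 +
        ‖∑ m, c m * Complex.exp (-(2 * θ * Complex.I)) ^ p m‖ ^ 2) / 2 := by
  choose α β hψ hs hc using grover_pow_mulVec U hθ
  have hcos : Real.cos θ ^ 2 = ∑ j, ‖U.1 (j, 0) 0‖ ^ 2 := by
    rw [Real.cos_sq', hθ, ← sum_norm_sq_column U]
    ring
  set X : ℂ := ∑ m, c m * (Real.sin ((2 * p m + 1) * θ) : ℂ) with hX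
  set Y : ℂ := ∑ m, c m * (Real.cos ((2 * p m + 1) * θ) : ℂ) with hY
  have hX1 : X = Real.sin θ * ∑ m, c m * (α (p m) : ℂ) := by
    rw [hX, Finset.mul_sum]
    refine Finset.sum_congr rfl fun m _ => ?_
    rw [← hs]
    push_cast
    ring
  have hY1 : Y = Real.cos θ * ∑ m, c m * (β (p m) : ℂ) := by
    rw [hY, Finset.mul_sum]
    refine Finset.sum_congr rfl fun m _ => ?_
    rw [← hc]
    push_cast
    ring
  have h1 : ∑ o, ‖∑ m, c m * ((grover U ^ p m) *ᵥ fun o => U.1 o 0) o‖ ^ 2 =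
      ‖Y‖ ^ 2 + ‖X‖ ^ 2 := by
    simp only [hψ]
    rw [Fintype.sum_prod_type]
    simp only [Fin.sum_univ_two, Finset.sum_add_distrib]
    rw [hX1, hY1, norm_mul, norm_mul, mul_pow, mul_pow, Complex.norm_real, Complex.norm_real,
      Real.norm_eq_abs, Real.norm_eq_abs, sq_abs, sq_abs, hθ, hcos, successProb, Finset.sum_mul,
      Finset.sum_mul]
    congr 1 <;>
    · refine Finset.sum_congr rfl fun j _ => ?_
      rw [← mul_pow, ← norm_mul, Finset.mul_sum]
      congr 2
      refine Finset.sum_congr rfl fun m _ => ?_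
      simp
      ring
  have h2 : ∀ t : ℝ, ‖∑ m, c m * Complex.exp (2 * t * Complex.I) ^ p m‖ =
      ‖∑ m, c m * Complex.exp (((2 * p m + 1) * t : ℝ) * Complex.I)‖ := by
    intro t
    have : ∑ m, c m * Complex.exp (((2 * p m + 1) * t : ℝ) * Complex.I) =
        Complex.exp (t * Complex.I) * ∑ m, c m * Complex.exp (2 * t * Complex.I) ^ p m := by
      rw [Finset.mul_sum]
      refine Finset.sum_congr rfl fun m _ => ?_
      rw [← Complex.exp_nat_mul, mul_left_comm, ← Complex.exp_add]
      congr 2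
      push_cast
      ring
    rw [this, norm_mul, Complex.norm_exp_ofReal_mul_I, one_mul]
  have h3 : ∑ m, c m * Complex.exp (((2 * p m + 1) * θ : ℝ) * Complex.I) = Y + Complex.I * X := by
    rw [hX, hY, Finset.mul_sum, ← Finset.sum_add_distrib]
    refine Finset.sum_congr rfl fun m _ => ?_
    rw [Complex.exp_mul_I, ← Complex.ofReal_cos, ← Complex.ofReal_sin]
    ring
  have h4 : ∑ m, c m * Complex.exp (((2 * p m + 1) * (-θ) : ℝ) * Complex.I) =
      Y - Complex.I * X := by
    rw [hX, hY, Finset.mul_sum, ← Finset.sum_sub_distrib]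
    refine Finset.sum_congr rfl fun m _ => ?_
    rw [Complex.exp_mul_I, ← Complex.ofReal_cos, ← Complex.ofReal_sin, mul_neg, Real.cos_neg,
      Real.sin_neg]
    push_cast
    ring
  have h5 := h2 (-θ)
  rw [h4, Complex.ofReal_neg, mul_neg, neg_mul] at h5
  rw [h1, h5, h2 θ, h3, parallelogram_law_with_norm ℂ, norm_mul, Complex.norm_I]
  ring

/-- Amplitude estimation with additive error `η` and failure probability `2 ^ (1 - r)`. The
estimate is `sin²` of the measured angle, that is `(1 - Re ω) / 2` for the measured root of
unity `ω`; it does not distinguish the two eigenphases `± 2 θ`. -/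
lemma exists_amplitude_estimation (k : Fin K) {r L : ℕ} (hr : 1 ≤ r) (hL : 1 ≤ L) {η : ℝ}
    (hη : 0 < η) (hηL : 2 ≤ η * L) :
    ∃ (Ψ : Oracles n K → ZMod (2 ^ (r * (L - 1))) × OracleReg n → ℂ)
      (out : ZMod (2 ^ (r * (L - 1))) × OracleReg n → ℝ),
      Prepares (ZMod (2 ^ (r * (L - 1)))) 0 (1 + 2 * (r * (L - 1))) Ψ ∧
      ∀ U, ∑ x with η < |out x - successProb (U k)|, ‖Ψ U x‖ ^ 2 ≤ (1 / 2) ^ (r - 1) := by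
  set D := r * (L - 1) with hD
  have hDN : D < 2 ^ D := Nat.lt_two_pow_self
  have hLN : L ≤ 2 ^ D := by
    have : L - 1 < 2 ^ (L - 1) := Nat.lt_two_pow_self
    have h2 : 2 ^ (L - 1) ≤ 2 ^ D := Nat.pow_le_pow_right (by norm_num)
      (Nat.le_mul_of_pos_left _ hr)
    omega
  set Z := ∑ m : ZMod (2 ^ D), (window r L).coeff m.val ^ 2 with hZ
  have hwin : (L : ℝ) ^ (2 * r) ≤ r * L * Z := window_sum_sq_ge hr hL hDN
  have hL0 : (0 : ℝ) < L := by exact_mod_cast hL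
  have hr0 : (0 : ℝ) < r := by exact_mod_cast hr
  have hZ0 : 0 < Z := by
    have : 0 < (r * L : ℝ) * Z := lt_of_lt_of_le (by positivity) hwin
    exact pos_of_mul_pos_right this (by positivity)
  let w : ZMod (2 ^ D) → ℂ := fun m => ((window r L).coeff m.val : ℂ) / (√Z : ℂ)
  have hw : ∑ m, ‖w m‖ ^ 2 = 1 := by
    have : ∀ m, ‖w m‖ ^ 2 = (window r L).coeff m.val ^ 2 / Z := fun m => by
      rw [norm_div, Complex.norm_real, Complex.norm_real, div_pow, Real.norm_eq_abs, sq_abs,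
        Real.norm_eq_abs, sq_abs, Real.sq_sqrt hZ0.le]
    simp only [this]
    rw [← Finset.sum_div, ← hZ, div_self hZ0.ne']
  let est : ZMod (2 ^ D) → ℝ := fun y => (1 - (ZMod.stdAddChar y : ℂ).re) / 2
  refine ⟨_, fun x => est x.1, prepares_phase_estimation k D hw, fun U => ?_⟩
  set μ := successProb (U k) with hμ
  obtain ⟨θ, hθ⟩ : ∃ θ : ℝ, Real.sin θ ^ 2 = μ := by
    have h0 : 0 ≤ μ := Finset.sum_nonneg fun _ _ => sq_nonneg _
    have h1 : μ ≤ 1 := by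
      rw [← sum_norm_sq_column (U k)]
      exact le_add_of_nonneg_right (Finset.sum_nonneg fun _ _ => sq_nonneg _)
    refine ⟨Real.arcsin √μ, ?_⟩
    rw [Real.sin_arcsin (by linarith [Real.sqrt_nonneg μ]) (Real.sqrt_le_one.2 h1),
      Real.sq_sqrt h0]
  set B : Finset (ZMod (2 ^ D)) := {y | η < |est y - μ|} with hB
  have hfilter : ({x : ZMod (2 ^ D) × OracleReg n | η < |est x.1 - μ|} : Finset _) =
      B ×ˢ Finset.univ := by
    ext x
    simp [hB]
  rw [hfilter, Finset.sum_product]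
  have key : ∀ y, ∑ o, ‖∑ m, fourierMatrix (2 ^ D) y m *
        (w m * ((grover (U k) ^ min m.val D) *ᵥ fun o => (U k).1 o 0) o)‖ ^ 2 =
      (‖∑ m, fourierMatrix (2 ^ D) y m * (((window r L).coeff m.val : ℂ) *
          Complex.exp (2 * θ * Complex.I) ^ m.val)‖ ^ 2 +
        ‖∑ m, fourierMatrix (2 ^ D) y m * (((window r L).coeff m.val : ℂ) *
          Complex.exp (-(2 * θ * Complex.I)) ^ m.val)‖ ^ 2) / 2 / Z := by
    intro y
    simp only [← mul_assoc]
    have hcoef : ∀ v : ℂ, ‖∑ m : ZMod (2 ^ D), fourierMatrix (2 ^ D) y m * w m *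
        v ^ min m.val D‖ ^ 2 = ‖∑ m : ZMod (2 ^ D), fourierMatrix (2 ^ D) y m *
          ((window r L).coeff m.val : ℂ) * v ^ m.val‖ ^ 2 / Z := by
      intro v
      have : ∀ m : ZMod (2 ^ D), fourierMatrix (2 ^ D) y m * w m * v ^ min m.val D =
          fourierMatrix (2 ^ D) y m * ((window r L).coeff m.val : ℂ) * v ^ m.val / (√Z : ℂ) := by
        intro m
        -- Beyond the degree of the window its amplitudes vanish, so capping the power is harmless.
        rcases le_or_gt m.val D with hm | hm
        · rw [min_eq_left hm]
          ring
        · have : (window r L).coeff m.val = 0 :=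
            Polynomial.coeff_eq_zero_of_natDegree_lt ((natDegree_window_le r L).trans_lt hm)
          simp [w, this]
      simp only [this]
      rw [← Finset.sum_div, norm_div, div_pow, Complex.norm_real, Real.norm_eq_abs, sq_abs,
        Real.sq_sqrt hZ0.le]
    rw [sum_norm_sq_phase_estimation (U k) hθ, hcoef, hcoef]
    ring
  simp only [key]
  rw [← Finset.sum_div, ← Finset.sum_div, Finset.sum_add_distrib]
  -- Both eigenphases `exp (± 2 i θ)` have real part `1 - 2 μ`, so a wrong estimate is far from both.
  have hre : ∀ v : ℂ, v.re = 1 - 2 * μ → ∀ y ∈ B, 2 * η ≤ ‖ZMod.stdAddChar y - v‖ := by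
    intro v hv y hy
    have h1 : η < |est y - μ| := by simpa [hB] using hy
    have h2 : |(ZMod.stdAddChar y - v).re| ≤ ‖ZMod.stdAddChar y - v‖ := Complex.abs_re_le_norm _
    rw [Complex.sub_re, hv] at h2
    have h3 : |(ZMod.stdAddChar y : ℂ).re - (1 - 2 * μ)| = 2 * |est y - μ| := by
      rw [← abs_neg, ← abs_two (α := ℝ), ← abs_mul, abs_two]
      congr 1
      simp only [est]
      ring
    linarith
  have hcos : Real.cos (2 * θ) = 1 - 2 * μ := by
    rw [Real.cos_two_mul, Real.cos_sq', hθ]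
    ring
  have hu : ∀ t : ℝ, Real.cos t = 1 - 2 * μ →
      ∑ y ∈ B, ‖∑ m, fourierMatrix (2 ^ D) y m * (((window r L).coeff m.val : ℂ) *
        Complex.exp (t * Complex.I) ^ m.val)‖ ^ 2 ≤ (1 / η) ^ (2 * (r - 1)) * L := fun t ht =>
    window_tail_le hr hDN hLN (Complex.norm_exp_ofReal_mul_I t) hη B
      (hre _ (by rw [Complex.exp_ofReal_mul_I_re, ht]))
  have h1 := hu (2 * θ) hcos
  have h2 := hu (-(2 * θ)) (by rw [Real.cos_neg, hcos])
  push_cast at h1 h2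
  rw [neg_mul] at h2
  have h3 : (1 / η) ^ (2 * (r - 1)) * L ≤ (1 / 2) ^ (r - 1) * Z := by
    obtain ⟨q, rfl⟩ := Nat.exists_eq_add_of_le' hr
    rw [Nat.add_sub_cancel]
    have hq : ((q + 1 : ℕ) : ℝ) ≤ 2 ^ q := by exact_mod_cast Nat.lt_two_pow_self
    have e1 : (1 / η) ^ (2 * q) * 2 ^ (2 * q) ≤ (L : ℝ) ^ (2 * q) := by
      rw [← mul_pow]
      refine pow_le_pow_left₀ (by positivity) ?_ _
      rw [one_div, inv_mul_le_iff₀ hη]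
      exact hηL
    have e2 : (L : ℝ) ^ (2 * q) * L ≤ (q + 1 : ℕ) * Z := by
      have : (L : ℝ) * (L ^ (2 * q) * L) ≤ L * ((q + 1 : ℕ) * Z) := by
        calc (L : ℝ) * (L ^ (2 * q) * L) = L ^ (2 * (q + 1)) := by ring
          _ ≤ _ := hwin
          _ = _ := by ring
      exact le_of_mul_le_mul_left this hL0
    have e3 : (1 / η) ^ (2 * q) * L * 2 ^ (2 * q) ≤ 2 ^ q * Z := by
      calc (1 / η) ^ (2 * q) * L * 2 ^ (2 * q) = (1 / η) ^ (2 * q) * 2 ^ (2 * q) * L := by ring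
        _ ≤ L ^ (2 * q) * L := by gcongr
        _ ≤ (q + 1 : ℕ) * Z := e2
        _ ≤ 2 ^ q * Z := by gcongr
    have e4 : (1 / 2 : ℝ) ^ q * Z * 2 ^ (2 * q) = 2 ^ q * Z := by
      rw [two_mul q, pow_add, one_div, inv_pow]
      field_simp
    exact le_of_mul_le_mul_right (e3.trans e4.ge) (by positivity)
  rw [div_le_iff₀ hZ0]
  linarith

end AmplitudeEstimation

/-! ### Accuracy of the estimated distribution function -/

section Analysis

variable {a b : ℝ}

lemma cosBasis_of_mem {k : ℕ} {x : ℝ} (hx : x ∈ Set.Icc a b) :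
    cosBasis a b k x = if k = 0 then 1 / √(b - a)
      else √(2 / (b - a)) * Real.cos (k * Real.pi * (x - a) / (b - a)) :=
  Set.indicator_of_mem hx _

lemma cosBasis_of_notMem {k : ℕ} {x : ℝ} (hx : x ∉ Set.Icc a b) : cosBasis a b k x = 0 :=
  Set.indicator_of_notMem hx _

lemma cosBasis_zero_of_mem {x : ℝ} (hx : x ∈ Set.Icc a b) : cosBasis a b 0 x = 1 / √(b - a) := by
  rw [cosBasis_of_mem hx, if_pos rfl]

lemma abs_cosBasis_le (hab : a < b) (k : ℕ) (x : ℝ) : |cosBasis a b k x| ≤ √(2 / (b - a)) := by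
  have hba : 0 < b - a := sub_pos.2 hab
  by_cases hx : x ∈ Set.Icc a b
  · rw [cosBasis_of_mem hx]
    split_ifs
    · rw [abs_of_nonneg (by positivity), ← Real.sqrt_one, ← Real.sqrt_div zero_le_one]
      gcongr
      norm_num
    · rw [abs_mul, abs_of_nonneg (Real.sqrt_nonneg _)]
      exact mul_le_of_le_one_right (Real.sqrt_nonneg _) (Real.abs_cos_le_one _)
  · rw [cosBasis_of_notMem hx, abs_zero]
    positivity

lemma measurable_cosBasis (k : ℕ) : Measurable (cosBasis a b k) := by
  unfold cosBasis
  refine Measurable.indicator ?_ measurableSet_Icc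
  split_ifs <;> fun_prop

lemma intervalIntegrable_cosBasis (hab : a < b) (k : ℕ) (x y : ℝ) :
    IntervalIntegrable (cosBasis a b k) volume x y :=
  intervalIntegrable_const (c := √(2 / (b - a))).mono_fun
    (measurable_cosBasis k).aestronglyMeasurable
    (ae_of_all _ fun t => by
      simpa [abs_of_nonneg (Real.sqrt_nonneg _)] using abs_cosBasis_le hab k t)

lemma abs_cosPrimitive_le (hab : a < b) (k : ℕ) {x : ℝ} (hax : a ≤ x) (hxb : x ≤ b) :
    |cosPrimitive a b k x| ≤ √(2 * (b - a)) := by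
  have hba : 0 < b - a := sub_pos.2 hab
  have h := intervalIntegral.norm_integral_le_of_norm_le_const (a := a) (b := x)
    (f := cosBasis a b k) (C := √(2 / (b - a))) fun t _ => abs_cosBasis_le hab k t
  rw [Real.norm_eq_abs, abs_of_nonneg (sub_nonneg.2 hax)] at h
  refine h.trans ((mul_le_mul_of_nonneg_left (sub_le_sub_right hxb a)
    (Real.sqrt_nonneg _)).trans (le_of_eq ?_))
  rw [show 2 * (b - a) = 2 / (b - a) * (b - a) ^ 2 by field_simp,
    Real.sqrt_mul (by positivity), Real.sqrt_sq hba.le]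

/-- Under either rate the choice of `K` makes the truncation error at most `ε / (4 (b - a))`. -/
lemma truncation_error_le (hab : a < b) {ε : ℝ} (hε : 0 < ε) {K : ℕ} (hK : 1 ≤ K) {f : ℝ → ℝ}
    (h : (∃ (m : ℕ) (ζ : ℝ), 1 ≤ m ∧ 0 < ζ ∧ AlgebraicRate f a b ζ m ∧
        K = ⌈(4 * ζ * (b - a) / ε) ^ (1 / (m : ℝ))⌉₊) ∨
      (∃ ν ζ : ℝ, 0 < ν ∧ 0 < ζ ∧ ExponentialRate f a b ζ ν ∧
        K = max 1 ⌈Real.log ((4 * ζ * (b - a) / ε) ^ (1 / ν))⌉₊))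
    {x : ℝ} (hx : x ∈ Set.Icc a b) :
    |cosPartialSum f a b K x - f x| ≤ ε / (4 * (b - a)) := by
  have hba : 0 < b - a := sub_pos.2 hab
  have hK0 : (0 : ℝ) < K := by exact_mod_cast hK
  rcases h with ⟨m, ζ, hm, hζ, hrate, hKm⟩ | ⟨ν, ζ, hν, hζ, hrate, hKν⟩
  · refine (hrate K hK x hx).trans ?_
    have hm0 : (0 : ℝ) < m := by exact_mod_cast hm
    have h1 : (4 * ζ * (b - a) / ε) ^ (1 / (m : ℝ)) ≤ K := by
      rw [hKm]
      exact Nat.le_ceil _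
    have h2 : 4 * ζ * (b - a) / ε ≤ (K : ℝ) ^ (m : ℝ) := by
      have := Real.rpow_le_rpow (by positivity) h1 hm0.le
      rwa [← Real.rpow_mul (by positivity), one_div_mul_cancel hm0.ne', Real.rpow_one] at this
    rw [Real.rpow_neg hK0.le, ← div_eq_mul_inv, div_le_div_iff₀ (by positivity) (by positivity)]
    rw [div_le_iff₀ hε] at h2
    linarith
  · refine (hrate K hK x hx).trans ?_
    have hpos : 0 < 4 * ζ * (b - a) / ε := by positivity
    have h1 : Real.log (4 * ζ * (b - a) / ε) ≤ ν * K := by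
      have : Real.log ((4 * ζ * (b - a) / ε) ^ (1 / ν)) ≤ K := by
        rw [hKν]
        exact (Nat.le_ceil _).trans (by exact_mod_cast le_max_right _ _)
      rw [Real.log_rpow hpos, one_div, inv_mul_le_iff₀ hν] at this
      exact this
    have h2 : 4 * ζ * (b - a) / ε ≤ Real.exp (ν * K) := (Real.log_le_iff_le_exp hpos).1 h1
    rw [neg_mul, Real.exp_neg, ← div_eq_mul_inv,
      div_le_div_iff₀ (by positivity) (by positivity)]
    rw [div_le_iff₀ hε] at h2
    linarith

section Density

variable {ν : Measure ℝ} {f : ℝ → ℝ}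

lemma integrable_of_eq_withDensity [IsProbabilityMeasure ν] (hf : Measurable f) (hf0 : ∀ x, 0 ≤ f x)
    (hν : ν = volume.withDensity (fun x => ENNReal.ofReal (f x))) : Integrable f := by
  rw [← lintegral_ofReal_ne_top_iff_integrable hf.aestronglyMeasurable (ae_of_all _ hf0)]
  have h : ν Set.univ = ∫⁻ x, ENNReal.ofReal (f x) := by
    rw [hν, withDensity_apply _ MeasurableSet.univ, Measure.restrict_univ]
  rw [← h]
  exact measure_ne_top _ _

lemma cdf_sub_cdf [IsProbabilityMeasure ν] (hf : Measurable f) (hf0 : ∀ x, 0 ≤ f x)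
    (hν : ν = volume.withDensity (fun x => ENNReal.ofReal (f x))) (x y : ℝ) :
    cdf ν y - cdf ν x = ∫ t in x..y, f t := by
  have hfi := integrable_of_eq_withDensity hf hf0 hν
  have h : ∀ x, cdf ν x = ∫ t in Set.Iic x, f t := fun x => by
    rw [cdf_eq_real, integral_eq_lintegral_of_nonneg_ae (ae_of_all _ hf0)
      hf.aestronglyMeasurable, ← withDensity_apply _ measurableSet_Iic, ← hν, measureReal_def]
  rw [h, h, intervalIntegral.integral_Iic_sub_Iic hfi.integrableOn hfi.integrableOn]

lemma intervalIntegrable_cosPartialSum (hab : a < b) (K : ℕ) (x y : ℝ) :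
    IntervalIntegrable (cosPartialSum f a b K) volume x y := by
  have : cosPartialSum f a b K =
      ∑ k ∈ Finset.range K, fun t => cosCoeff f a b k * cosBasis a b k t := by
    ext t
    simp [cosPartialSum]
  rw [this]
  exact IntervalIntegrable.sum _ fun k _ =>
    (intervalIntegrable_cosBasis hab k x y).const_mul _

lemma integral_cosPartialSum (hab : a < b) (K : ℕ) (x : ℝ) :
    ∫ t in a..x, cosPartialSum f a b K t =
      ∑ k ∈ Finset.range K, cosCoeff f a b k * cosPrimitive a b k x := by
  simp only [cosPartialSum]
  rw [intervalIntegral.integral_finsetSum fun k _ =>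
    (intervalIntegrable_cosBasis hab k a x).const_mul _]
  simp only [intervalIntegral.integral_const_mul, cosPrimitive]

lemma abs_integral_truncation_le (hab : a < b) (hfi : Integrable f) {K : ℕ} {ε : ℝ}
    (htrunc : ∀ x ∈ Set.Icc a b, |cosPartialSum f a b K x - f x| ≤ ε / (4 * (b - a)))
    {x y : ℝ} (hax : a ≤ x) (hxy : x ≤ y) (hyb : y ≤ b) :
    |(∫ t in x..y, cosPartialSum f a b K t) - ∫ t in x..y, f t| ≤
      ε / 4 * ((y - x) / (b - a)) := by
  rw [← intervalIntegral.integral_sub (intervalIntegrable_cosPartialSum hab K x y)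
    hfi.intervalIntegrable]
  have h := intervalIntegral.norm_integral_le_of_norm_le_const (a := x) (b := y)
    (f := fun t => cosPartialSum f a b K t - f t) (C := ε / (4 * (b - a))) fun t ht => by
      rw [Set.uIoc_of_le hxy] at ht
      exact htrunc t ⟨hax.trans ht.1.le, ht.2.trans hyb⟩
  rw [Real.norm_eq_abs, abs_of_nonneg (sub_nonneg.2 hxy)] at h
  refine h.trans (le_of_eq ?_)
  have hba : b - a ≠ 0 := (sub_pos.2 hab).ne'
  field_simp

/-- Outside `[a, b)` the error of the estimate is controlled by the tails of the distribution. -/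
lemma abs_cdfEstimate_sub_cdf_le_of_forall_Ico {ε : ℝ} (hε : 0 < ε) {K : ℕ} {c : Fin K → ℝ}
    (hFa : cdf ν a ≤ ε / 2) (hFb : 1 - ε ≤ cdf ν b)
    (h : ∀ y, a ≤ y → y < b → |∑ k : Fin K, c k * cosPrimitive a b k y - cdf ν y| ≤ ε) (y : ℝ) :
    |cdfEstimate a b c y - cdf ν y| ≤ ε := by
  rw [cdfEstimate]
  split_ifs with h1 h2
  · rw [zero_sub, abs_neg, abs_of_nonneg (cdf_nonneg ν y)]
    linarith [monotone_cdf ν h1.le]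
  · exact h y (not_lt.1 h1) h2
  · rw [abs_of_nonneg (sub_nonneg.2 (cdf_le_one ν y))]
    linarith [monotone_cdf ν (not_lt.1 h2)]

/-- Coefficients with error `ε / (4 K √(2 (b - a)))` give the distribution function with error `ε`:
the coefficients and the truncation contribute `ε / 4` each, and the mass below `a` contributes
`ε / 2`. -/
lemma abs_cdfEstimate_sub_cdf_le [IsProbabilityMeasure ν] (hab : a < b) {ε : ℝ} (hε : 0 < ε) {K : ℕ} (hK : 1 ≤ K)
    (hf : Measurable f) (hf0 : ∀ x, 0 ≤ f x)
    (hν : ν = volume.withDensity (fun x => ENNReal.ofReal (f x)))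
    (hFa : cdf ν a ≤ ε / 2) (hFb : 1 - ε ≤ cdf ν b)
    (htrunc : ∀ x ∈ Set.Icc a b, |cosPartialSum f a b K x - f x| ≤ ε / (4 * (b - a)))
    {c : Fin K → ℝ}
    (hc : ∀ k : Fin K, |c k - cosCoeff f a b k| ≤ ε / (4 * K * √(2 * (b - a)))) (y : ℝ) :
    |cdfEstimate a b c y - cdf ν y| ≤ ε := by
  refine abs_cdfEstimate_sub_cdf_le_of_forall_Ico hε hFa hFb (fun y hay hyb => ?_) y
  have hba : 0 < b - a := sub_pos.2 hab
  have hK0 : (0 : ℝ) < K := by exact_mod_cast hK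
  have h1 : |∑ k : Fin K, c k * cosPrimitive a b k y -
      ∑ k ∈ Finset.range K, cosCoeff f a b k * cosPrimitive a b k y| ≤ ε / 4 := by
    rw [Finset.sum_range, ← Finset.sum_sub_distrib]
    refine (Finset.abs_sum_le_sum_abs _ _).trans ?_
    have : ∀ k : Fin K, |c k * cosPrimitive a b k y - cosCoeff f a b k * cosPrimitive a b k y| ≤
        ε / (4 * K) := fun k => by
      rw [← sub_mul, abs_mul]
      refine (mul_le_mul (hc k) (abs_cosPrimitive_le hab k hay hyb.le) (abs_nonneg _)
        (by positivity)).trans (le_of_eq ?_)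
      have : √(2 * (b - a)) ≠ 0 := by positivity
      field_simp
    refine (Finset.sum_le_sum fun k _ => this k).trans (le_of_eq ?_)
    rw [Finset.sum_const, Finset.card_univ, Fintype.card_fin, nsmul_eq_mul]
    field_simp
  have h2 := abs_integral_truncation_le hab (integrable_of_eq_withDensity hf hf0 hν) htrunc
    le_rfl hay hyb.le
  have h3 : ε / 4 * ((y - a) / (b - a)) ≤ ε / 4 :=
    mul_le_of_le_one_right (by positivity) ((div_le_one hba).2 (by linarith))
  rw [integral_cosPartialSum hab, ← cdf_sub_cdf hf hf0 hν] at h2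
  have h4 := cdf_nonneg ν a
  rw [abs_le] at h1 h2 ⊢
  constructor <;> linarith [h1.1, h1.2, h2.1, h2.2]

/-- If a single coefficient suffices, then the uniform distribution on `[a, b]` is accurate
enough, and nothing has to be estimated. -/
lemma abs_cdfEstimate_uniform_sub_cdf_le [IsProbabilityMeasure ν] (hab : a < b) {ε : ℝ} (hε : 0 < ε)
    (hf : Measurable f) (hf0 : ∀ x, 0 ≤ f x)
    (hν : ν = volume.withDensity (fun x => ENNReal.ofReal (f x)))
    (hFa : cdf ν a ≤ ε / 2) (hFb : 1 - ε ≤ cdf ν b)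
    (htrunc : ∀ x ∈ Set.Icc a b, |cosPartialSum f a b 1 x - f x| ≤ ε / (4 * (b - a))) (y : ℝ) :
    |cdfEstimate a b (fun _ : Fin 1 => 1 / √(b - a)) y - cdf ν y| ≤ ε := by
  refine abs_cdfEstimate_sub_cdf_le_of_forall_Ico hε hFa hFb (fun y hay hyb => ?_) y
  have hba : 0 < b - a := sub_pos.2 hab
  have hsq : 1 / √(b - a) * (1 / √(b - a)) = 1 / (b - a) := by
    rw [div_mul_div_comm, Real.mul_self_sqrt hba.le, one_mul]
  have hfi := integrable_of_eq_withDensity hf hf0 hν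
  have hprim : ∀ x, a ≤ x → x ≤ b → ∫ t in a..x, cosBasis a b 0 t = (x - a) * (1 / √(b - a)) := by
    intro x hax hxb
    rw [intervalIntegral.integral_congr (g := fun _ => 1 / √(b - a)),
      intervalIntegral.integral_const, smul_eq_mul]
    intro t ht
    rw [Set.uIcc_of_le hax] at ht
    exact cosBasis_zero_of_mem ⟨ht.1, ht.2.trans hxb⟩
  have hcoef : cosCoeff f a b 0 = (cdf ν b - cdf ν a) * (1 / √(b - a)) := by
    rw [cdf_sub_cdf hf hf0 hν, ← intervalIntegral.integral_mul_const, cosCoeff]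
    refine intervalIntegral.integral_congr fun t ht => ?_
    rw [Set.uIcc_of_le hab.le] at ht
    simp only [cosBasis_zero_of_mem ht]
  have hpart : ∀ x, a ≤ x → x ≤ b → ∫ t in a..x, cosPartialSum f a b 1 t =
      (cdf ν b - cdf ν a) * ((x - a) / (b - a)) := by
    intro x hax hxb
    rw [integral_cosPartialSum hab, Finset.sum_range_one, hcoef, cosPrimitive, hprim x hax hxb,
      mul_mul_mul_comm, hsq]
    ring
  have h1 := abs_integral_truncation_le hab hfi htrunc le_rfl hay hyb.le
  have h2 := abs_integral_truncation_le hab hfi htrunc hay hyb.le le_rfl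
  have hint := intervalIntegrable_cosPartialSum (f := f) hab 1
  rw [← intervalIntegral.integral_interval_sub_left (hint a b) (hint a y), hpart b hab.le le_rfl,
    hpart y hay hyb.le, div_self hba.ne', ← cdf_sub_cdf hf hf0 hν] at h2
  rw [hpart y hay hyb.le, ← cdf_sub_cdf hf hf0 hν] at h1
  have hest : ∑ k : Fin 1, 1 / √(b - a) * cosPrimitive a b k y = (y - a) / (b - a) := by
    rw [Fin.sum_univ_one, Fin.val_zero, cosPrimitive, hprim y hay hyb.le, mul_left_comm, hsq,
      mul_one_div]
  rw [hest]
  rw [show (b - y) / (b - a) = 1 - (y - a) / (b - a) by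
    rw [eq_sub_iff_add_eq, ← add_div, sub_add_sub_cancel, div_self hba.ne']] at h2
  have ht0 : 0 ≤ (y - a) / (b - a) := div_nonneg (sub_nonneg.2 hay) hba.le
  have ht1 : (y - a) / (b - a) ≤ 1 := (div_le_one hba).2 (by linarith)
  set t := (y - a) / (b - a)
  have hF0 := cdf_nonneg ν a
  have hF1 := cdf_le_one ν b
  rw [abs_le] at h1 h2 ⊢
  constructor
  · nlinarith [h1.1, mul_nonneg ht0 (sub_nonneg.2 hF1), mul_nonneg ht0 hF0,
      mul_le_mul_of_nonneg_left ht1 hε.le]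
  · nlinarith [h2.2, mul_nonneg (sub_nonneg.2 ht1) hF0, mul_nonneg ht0 (sub_nonneg.2 hFb),
      mul_le_mul_of_nonneg_left ht1 hε.le]

end Density

end Analysis

/-! ### Estimating all coefficients -/

section Estimation

variable {n K : ℕ}

lemma sum_prod_mul {A B : Type*} [Fintype A] [Fintype B] (f : A → ℝ) (g : B → ℝ) :
    ∑ x : A × B, f x.1 * g x.2 = (∑ a, f a) * ∑ b, g b := by
  rw [Fintype.sum_prod_type, Fintype.sum_mul_sum]

open Classical in
/-- Amplitude estimation for all black boxes in `T`, one after the other, with a union bound for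
the failure probabilities. -/
lemma exists_amplitude_estimation_finset (T : Finset (Fin K)) {r L : ℕ} (hr : 1 ≤ r) (hL : 1 ≤ L)
    {η : ℝ} (hη : 0 < η) (hηL : 2 ≤ η * L) :
    ∃ (W : Type) (_ : Fintype W) (_ : DecidableEq W) (z : W) (w : ℕ)
      (Ψ : Oracles n K → W × OracleReg n → ℂ) (out : W × OracleReg n → Fin K → ℝ),
      Fintype.card W = 2 ^ w ∧ Prepares W z (T.card * (1 + 2 * (r * (L - 1)))) Ψ ∧
      ∀ U, ∑ x with ∃ k ∈ T, η < |out x k - successProb (U k)|, ‖Ψ U x‖ ^ 2 ≤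
        T.card * (1 / 2 : ℝ) ^ (r - 1) := by
  induction T using Finset.induction_on with
  | empty =>
    refine ⟨Unit, inferInstance, inferInstance, (), 0, _, fun _ _ => 0, by simp,
      ⟨_, by simpa using Implements.gate 1 (one_mem _), fun U => rfl⟩, by simp⟩
  | insert k T hk ih =>
    obtain ⟨W, _, _, z, w, Ψ, out, hW, hΨ, hbad⟩ := ih
    obtain ⟨Ψ₁, out₁, hΨ₁, hbad₁⟩ := exists_amplitude_estimation (n := n) k hr hL hη hηL
    have hprod := hΨ₁.prod hΨ
    rw [show 1 + 2 * (r * (L - 1)) + T.card * (1 + 2 * (r * (L - 1))) =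
      (insert k T).card * (1 + 2 * (r * (L - 1))) by
        rw [Finset.card_insert_of_notMem hk]; ring] at hprod
    refine ⟨(ZMod (2 ^ (r * (L - 1))) × OracleReg n) × W, inferInstance, inferInstance, _,
      r * (L - 1) + (n + 1) + w, _,
      fun x j => if j = k then out₁ x.1.1 else out (x.1.2, x.2) j, ?_, hprod, ?_⟩
    · simp [hW, ZMod.card, pow_add]
    · intro U
      have hle : ∀ x : (ZMod (2 ^ (r * (L - 1))) × OracleReg n) × (W × OracleReg n),
          (if ∃ j ∈ insert k T, η < |(if j = k then out₁ x.1 else out x.2 j) - successProb (U j)|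
            then ‖Ψ₁ U x.1 * Ψ U x.2‖ ^ 2 else 0) ≤
          (if η < |out₁ x.1 - successProb (U k)| then ‖Ψ₁ U x.1‖ ^ 2 else 0) * ‖Ψ U x.2‖ ^ 2 +
          ‖Ψ₁ U x.1‖ ^ 2 * (if ∃ j ∈ T, η < |out x.2 j - successProb (U j)|
            then ‖Ψ U x.2‖ ^ 2 else 0) := by
        intro x
        rw [norm_mul, mul_pow]
        by_cases h1 : η < |out₁ x.1 - successProb (U k)|
        · rw [if_pos h1]
          refine le_add_of_le_of_nonneg ?_ (mul_nonneg (sq_nonneg _) (by split_ifs <;> positivity))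
          split_ifs
          · exact le_rfl
          · positivity
        · by_cases h2 : ∃ j ∈ T, η < |out x.2 j - successProb (U j)|
          · rw [if_neg h1, if_pos h2, zero_mul, zero_add]
            split_ifs
            · exact le_rfl
            · positivity
          · rw [if_neg, if_neg h1, if_neg h2]
            · simp
            · rintro ⟨j, hj, hj'⟩
              rcases Finset.mem_insert.1 hj with rfl | hjT
              · exact h1 (by simpa using hj')
              · have : j ≠ k := fun h => hk (h ▸ hjT)
                exact h2 ⟨j, hjT, by simpa [this] using hj'⟩
      have hsum : ∑ x : (ZMod (2 ^ (r * (L - 1))) × OracleReg n) × (W × OracleReg n),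
          (if ∃ j ∈ insert k T, η < |(if j = k then out₁ x.1 else out x.2 j) - successProb (U j)|
            then ‖Ψ₁ U x.1 * Ψ U x.2‖ ^ 2 else 0) ≤
          (1 / 2 : ℝ) ^ (r - 1) + T.card * (1 / 2 : ℝ) ^ (r - 1) := by
        refine (Finset.sum_le_sum fun x _ => hle x).trans ?_
        rw [Finset.sum_add_distrib,
          sum_prod_mul (fun u => if η < |out₁ u - successProb (U k)| then ‖Ψ₁ U u‖ ^ 2 else 0)
            (fun v => ‖Ψ U v‖ ^ 2),
          sum_prod_mul (fun u => ‖Ψ₁ U u‖ ^ 2)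
            (fun v => if ∃ j ∈ T, η < |out v j - successProb (U j)| then ‖Ψ U v‖ ^ 2 else 0),
          hΨ.sum_norm_sq, hΨ₁.sum_norm_sq,
          mul_one, one_mul, ← Finset.sum_filter, ← Finset.sum_filter]
        exact add_le_add (hbad₁ U) (hbad U)
      rw [Finset.card_insert_of_notMem hk, Nat.cast_succ, add_one_mul, add_comm (_ * _)]
      refine le_trans (le_of_eq ?_) hsum
      rw [Finset.sum_filter]
      exact Fintype.sum_equiv (Equiv.prodAssoc _ W (OracleReg n)) _ _ fun x => rfl

lemma nodeWeight_nonneg {f : ℝ → ℝ} (hf0 : ∀ x, 0 ≤ f x) (x : Qubits n → ℝ) (j : Qubits n) :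
    0 ≤ nodeWeight f x j :=
  div_nonneg (hf0 _) (Finset.sum_nonneg fun _ _ => hf0 _)

namespace Loads

variable {U : Matrix.unitaryGroup (OracleReg n) ℂ} {f : ℝ → ℝ} {x : Qubits n → ℝ} {φ : ℝ → ℝ}

lemma successProb_eq (h : Loads U f x φ) (hf0 : ∀ x, 0 ≤ f x) :
    successProb U = riemannSum f x φ := by
  refine Finset.sum_congr rfl fun j _ => ?_
  have h1 := (h.2 j).1
  rw [← Prod.mk_zero_zero, h1, Complex.norm_real, Real.norm_eq_abs, sq_abs,
    Real.sq_sqrt (mul_nonneg (nodeWeight_nonneg hf0 x j) (h.1 j).1)]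

/-- A unitary can load the weights only if they sum to `1`; in particular `f` does not vanish at
all nodes. -/
lemma sum_nodeWeight (h : Loads U f x φ) (hf0 : ∀ x, 0 ≤ f x) : ∑ j, nodeWeight f x j = 1 := by
  rw [← sum_norm_sq_column U, h.successProb_eq hf0, riemannSum, ← Finset.sum_add_distrib]
  refine Finset.sum_congr rfl fun j _ => ?_
  have h1 := (h.2 j).2
  rw [← Prod.mk_zero_zero, h1, Complex.norm_real, Real.norm_eq_abs, sq_abs,
    Real.sq_sqrt (mul_nonneg (nodeWeight_nonneg hf0 x j) (sub_nonneg.2 (h.1 j).2))]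
  ring

lemma riemannSum_cosBasis {a b s : ℝ} {k : ℕ} (hs : 0 < s)
    (h : Loads U f x (loadedBasis a b s k)) (hf0 : ∀ x, 0 ≤ f x) :
    riemannSum f x (cosBasis a b k) = s * (2 * successProb U - 1) := by
  rw [h.successProb_eq hf0, ← h.sum_nodeWeight hf0, riemannSum, riemannSum, Finset.mul_sum,
    ← Finset.sum_sub_distrib, Finset.mul_sum]
  refine Finset.sum_congr rfl fun j _ => ?_
  rw [loadedBasis]
  field_simp
  ring

end Loads

/-- If `s` is smaller than the constant `γ_0`, then all nodes lie outside `[a, b]`. -/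
lemma riemannSum_cosBasis_eq_zero {f : ℝ → ℝ} {x : Qubits n → ℝ} {a b s : ℝ} (hab : a < b)
    (hs : 0 < s) (hsb : s * √(b - a) < 1) {U : Matrix.unitaryGroup (OracleReg n) ℂ}
    (h : Loads U f x (loadedBasis a b s 0)) (k : ℕ) : riemannSum f x (cosBasis a b k) = 0 := by
  refine Finset.sum_eq_zero fun j _ => ?_
  rw [cosBasis_of_notMem, mul_zero]
  intro hj
  have h1 := (h.1 j).2
  have hpos : 0 < √(b - a) := Real.sqrt_pos.2 (sub_pos.2 hab)
  rw [loadedBasis, cosBasis_zero_of_mem hj] at h1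
  have h2 : 1 / √(b - a) / s ≤ 1 := by linarith
  rw [div_div, div_le_one (by positivity)] at h2
  linarith

/-- Numerical choice of the window: `L = ⌈2 / η⌉` and `r = 1 + ⌈log₂ (K / ϱ)⌉` reach the precision
`η` and the total failure probability `ϱ` within the claimed number of queries. -/
lemma query_bound {K : ℕ} (hK : 2 ≤ K) {S ε ϱ : ℝ} (hS : 1 ≤ S) (hε0 : 0 < ε) (hε1 : ε < 1)
    (hϱ0 : 0 < ϱ) (hϱ1 : ϱ < 1) {η : ℝ} (hη : η = ε / (16 * K * S * √2)) :
    ∃ r L : ℕ, 1 ≤ r ∧ 1 ≤ L ∧ 2 ≤ η * L ∧ (K : ℝ) * (1 / 2) ^ (r - 1) ≤ ϱ ∧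
      ((K * (1 + 2 * (r * (L - 1))) : ℕ) : ℝ) ≤
        1000 * (S * (K : ℝ) ^ 2 / ε * Real.log (K / ϱ)) := by
  have hK2 : (2 : ℝ) ≤ K := by exact_mod_cast hK
  have hK0 : (0 : ℝ) < K := by linarith
  have h2l : 1 < √2 := by rw [Real.lt_sqrt] <;> norm_num
  have h2u : √2 < 1.415 := by rw [Real.sqrt_lt] <;> norm_num
  have hη0 : 0 < η := by rw [hη]; positivity
  have hη1 : η ≤ 1 := by
    rw [hη, div_le_one (by positivity)]
    have : 1 ≤ 16 * K * S * √2 := by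
      have a1 : (1 : ℝ) ≤ 16 * K := by linarith
      exact one_le_mul_of_one_le_of_one_le (one_le_mul_of_one_le_of_one_le a1 hS) h2l.le
    linarith
  have hl2 : (0.69 : ℝ) < Real.log 2 := by linarith [Real.log_two_gt_d9]
  have hKϱ : 2 ≤ K / ϱ := by
    rw [le_div_iff₀ hϱ0]
    nlinarith
  set l := Real.log (K / ϱ) with hl
  have hlog : Real.log 2 ≤ l := Real.log_le_log (by norm_num) hKϱ
  have hl0 : 0 < l := by linarith
  have hq : (⌈l / Real.log 2⌉₊ : ℝ) < l / Real.log 2 + 1 := Nat.ceil_lt_add_one (div_nonneg hl0.le (by linarith))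
  have hq' : l / Real.log 2 ≤ ⌈l / Real.log 2⌉₊ := Nat.le_ceil _
  set q := ⌈l / Real.log 2⌉₊
  have hL' : 2 / η ≤ ⌈2 / η⌉₊ := Nat.le_ceil _
  have hL : (⌈2 / η⌉₊ : ℝ) < 2 / η + 1 := Nat.ceil_lt_add_one (by positivity)
  set L := ⌈2 / η⌉₊
  have hL1 : 1 ≤ L := Nat.one_le_iff_ne_zero.2 (Nat.ceil_pos.2 (by positivity)).ne'
  refine ⟨q + 1, L, by omega, hL1, ?_, ?_, ?_⟩
  · rw [div_le_iff₀ hη0] at hL'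
    linarith
  · rw [Nat.add_sub_cancel]
    have h1 : K / ϱ ≤ 2 ^ q := by
      rw [← Real.log_le_log_iff (by positivity) (by positivity), Real.log_pow, ← hl]
      rwa [div_le_iff₀ (by linarith)] at hq'
    rw [div_le_iff₀ hϱ0] at h1
    rw [one_div, inv_pow, ← div_eq_mul_inv, div_le_iff₀ (by positivity)]
    linarith
  · have hr : ((q + 1 : ℕ) : ℝ) ≤ 5 * l := by
      have e1 : l / Real.log 2 ≤ l / 0.69 := by gcongr
      have e2 : l / 0.69 ≤ 1.45 * l := by
        rw [div_le_iff₀ (by norm_num)]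
        linarith
      push_cast
      linarith
    have hL3 : (L : ℝ) ≤ 3 / η := by
      have : 1 ≤ 1 / η := by rwa [le_div_iff₀ hη0, one_mul]
      have : 3 / η = 2 / η + 1 / η := by ring
      linarith
    have hnat : K * (1 + 2 * ((q + 1) * (L - 1))) ≤ K * (2 * ((q + 1) * L)) := by
      obtain ⟨L', hL'⟩ := Nat.exists_eq_add_of_le' hL1
      rw [hL', Nat.add_sub_cancel]
      gcongr
      nlinarith
    calc ((K * (1 + 2 * ((q + 1) * (L - 1))) : ℕ) : ℝ)
        ≤ ((K * (2 * ((q + 1) * L)) : ℕ) : ℝ) := by exact_mod_cast hnat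
      _ = K * (2 * (((q + 1 : ℕ) : ℝ) * L)) := by push_cast; ring
      _ ≤ K * (2 * ((5 * l) * (3 / η))) := by gcongr
      _ = (480 * √2) * (S * (K : ℝ) ^ 2 / ε * l) := by
        rw [hη]
        field_simp
        ring
      _ ≤ 1000 * (S * (K : ℝ) ^ 2 / ε * l) := by
        gcongr
        linarith

/-- An algorithm without queries that always returns `c`. -/
def constAlgorithm (n : ℕ) {K : ℕ} (c : Fin K → ℝ) : QueryAlgorithm n K := ⟨0, [], fun _ => c⟩

lemma queryCount_constAlgorithm (c : Fin K → ℝ) : (constAlgorithm n c).queryCount = 0 := rfl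

lemma outputProb_constAlgorithm {c : Fin K → ℝ} {S : Set (Fin K → ℝ)} (hc : c ∈ S)
    (U : Oracles n K) : (constAlgorithm n c).outputProb U S = 1 := by
  refine (Finset.sum_congr rfl fun z _ => if_pos hc).trans ?_
  exact sum_norm_sq_single 0

end Estimation

end CosineQAE

theorem mainTheorem1 :
    ∃ C : ℝ, 0 < C ∧
      ∀ (n K : ℕ) (a b ε ϱ s : ℝ), 1 ≤ K → a < b → 0 < ε → ε < 1 → 0 < ϱ → ϱ < 1 → 0 < s →
        ∃ A : CosineQAE.QueryAlgorithm n K,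
          (A.queryCount : ℝ) ≤
            C * (s * √(b - a) * (K : ℝ) ^ 2 / ε * Real.log ((K : ℝ) / ϱ)) ∧
          ∀ {Ω : Type*} [MeasurableSpace Ω] (P : Measure Ω) [IsProbabilityMeasure P]
            (X : Ω → ℝ) (f : ℝ → ℝ),
            Measurable X → Measurable f → (∀ x, 0 ≤ f x) →
            P.map X = volume.withDensity (fun x => ENNReal.ofReal (f x)) →
            cdf (P.map X) a ≤ ε / 2 →
            1 - ε ≤ cdf (P.map X) b →
            ((∃ (m : ℕ) (ζ : ℝ), 1 ≤ m ∧ 0 < ζ ∧ CosineQAE.AlgebraicRate f a b ζ m ∧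
                K = ⌈(4 * ζ * (b - a) / ε) ^ (1 / (m : ℝ))⌉₊) ∨
              (∃ ν ζ : ℝ, 0 < ν ∧ 0 < ζ ∧ CosineQAE.ExponentialRate f a b ζ ν ∧
                K = max 1 ⌈Real.log ((4 * ζ * (b - a) / ε) ^ (1 / ν))⌉₊)) →
            ∀ (x : CosineQAE.Qubits n → ℝ)
              (U : Fin K → Matrix.unitaryGroup (CosineQAE.OracleReg n) ℂ),
              (∀ k : Fin K, CosineQAE.Loads (U k) f x (CosineQAE.loadedBasis a b s k)) →
              (∀ k : Fin K,
                |CosineQAE.riemannSum f x (CosineQAE.cosBasis a b k) -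
                    CosineQAE.cosCoeff f a b k| ≤ ε / (8 * K * √(2 * (b - a)))) →
              1 - ϱ ≤ A.outputProb U
                {c | ∀ y : ℝ, |CosineQAE.cdfEstimate a b c y - cdf (P.map X) y| ≤ ε} := by
  classical
  refine ⟨1000, by norm_num, fun n K a b ε ϱ s hK hab hε0 hε1 hϱ0 hϱ1 hs => ?_⟩
  have hba : 0 < b - a := sub_pos.2 hab
  have hK1 : (1 : ℝ) ≤ K := by exact_mod_cast hK
  have hlog : 0 ≤ Real.log ((K : ℝ) / ϱ) := by
    refine Real.log_nonneg ?_
    rw [le_div_iff₀ hϱ0]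
    linarith
  have hbound : 0 ≤ 1000 * (s * √(b - a) * (K : ℝ) ^ 2 / ε * Real.log ((K : ℝ) / ϱ)) := by
    positivity
  -- For `K = 1` and `ϱ` close to `1` the bound allows no query at all.
  rcases Nat.eq_or_lt_of_le hK with rfl | hK2
  · refine ⟨CosineQAE.constAlgorithm n fun _ => 1 / √(b - a), ?_, ?_⟩
    · rw [CosineQAE.queryCount_constAlgorithm, Nat.cast_zero]
      exact hbound
    · intro Ω _ P _ X f hX hf hf0 hmap hFa hFb hrate x U hU hR
      have : IsProbabilityMeasure (P.map X) := Measure.isProbabilityMeasure_map hX.aemeasurable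
      rw [CosineQAE.outputProb_constAlgorithm]
      · linarith
      · exact CosineQAE.abs_cdfEstimate_uniform_sub_cdf_le hab hε0 hf hf0 hmap hFa hFb
          fun x hx => CosineQAE.truncation_error_le hab hε0 hK hrate hx
  have htarget : ε / (4 * K * √(2 * (b - a))) =
      ε / (8 * K * √(2 * (b - a))) + ε / (8 * K * √(2 * (b - a))) := by
    have : √(2 * (b - a)) ≠ 0 := by positivity
    field_simp
    norm_num
  have hhalf : 0 < ε / (8 * K * √(2 * (b - a))) := by positivity
  rcases lt_or_ge (s * √(b - a)) 1 with hsb | hsb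
  -- No node lies in `[a, b]`: the Riemann sums vanish and need not be estimated.
  · refine ⟨CosineQAE.constAlgorithm n fun _ => 0, ?_, ?_⟩
    · rw [CosineQAE.queryCount_constAlgorithm, Nat.cast_zero]
      exact hbound
    · intro Ω _ P _ X f hX hf hf0 hmap hFa hFb hrate x U hU hR
      have : IsProbabilityMeasure (P.map X) := Measure.isProbabilityMeasure_map hX.aemeasurable
      rw [CosineQAE.outputProb_constAlgorithm]
      · linarith
      · refine CosineQAE.abs_cdfEstimate_sub_cdf_le hab hε0 hK hf hf0 hmap hFa hFb
          (fun x hx => CosineQAE.truncation_error_le hab hε0 hK hrate hx) fun k => ?_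
        have h := hR k
        rw [CosineQAE.riemannSum_cosBasis_eq_zero hab hs hsb (hU ⟨0, hK⟩)] at h
        linarith
  obtain ⟨r, L, hr, hL, hηL, hfail, hcost⟩ :=
    CosineQAE.query_bound hK2 hsb hε0 hε1 hϱ0 hϱ1 rfl
  set η := ε / (16 * K * (s * √(b - a)) * √2) with hη
  have hη0 : 0 < η := by positivity
  -- An error `η` of the success probability is an error `2 s η` of the Riemann sum.
  have hηs : 2 * s * η = ε / (8 * K * √(2 * (b - a))) := by
    rw [hη, Real.sqrt_mul zero_le_two]
    have : √(b - a) ≠ 0 := by positivity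
    field_simp
    norm_num
  obtain ⟨W, _, _, z, w, Ψ, out, hW, hΨ, hbad⟩ :=
    CosineQAE.exists_amplitude_estimation_finset (n := n) (Finset.univ : Finset (Fin K)) hr hL
      hη0 hηL
  rw [Finset.card_univ, Fintype.card_fin] at hΨ hbad
  obtain ⟨A, hA, hAprob⟩ := hΨ.exists_algorithm hW fun x k => s * (2 * out x k - 1)
  refine ⟨A, by rw [hA]; exact hcost, ?_⟩
  intro Ω _ P _ X f hX hf hf0 hmap hFa hFb hrate x U hU hR
  have : IsProbabilityMeasure (P.map X) := Measure.isProbabilityMeasure_map hX.aemeasurable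
  rw [hAprob]
  refine sub_le_sub_left (le_trans ?_ ((hbad U).trans hfail)) 1
  refine Finset.sum_le_sum_of_subset_of_nonneg (fun v hv => ?_) fun _ _ _ => sq_nonneg _
  rw [Finset.mem_filter] at hv ⊢
  refine ⟨Finset.mem_univ _, ?_⟩
  by_contra! hgood
  refine hv.2 (CosineQAE.abs_cdfEstimate_sub_cdf_le hab hε0 hK hf hf0 hmap hFa hFb
    (fun x hx => CosineQAE.truncation_error_le hab hε0 hK hrate hx) fun k => ?_)
  have h1 := hgood k (Finset.mem_univ k)
  have h2 : |s * (2 * out v k - 1) - CosineQAE.riemannSum f x (CosineQAE.cosBasis a b k)| ≤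
      ε / (8 * K * √(2 * (b - a))) := by
    rw [(hU k).riemannSum_cosBasis hs hf0, ← hηs,
      show s * (2 * out v k - 1) - s * (2 * CosineQAE.successProb (U k) - 1) =
        2 * s * (out v k - CosineQAE.successProb (U k)) by ring, abs_mul,
      abs_of_pos (by positivity : 0 < 2 * s)]
    gcongr
  rw [htarget]
  exact (abs_sub_le _ _ _).trans (add_le_add h2 (hR k))
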